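/- Let $K$ be an algebraically closed field, let $n,d\ge 2$ be coprime integers with $\operatorname{char}(K)\nmid n$, and let $\alpha_1,\dots,\alpha_d\in K$ be distinct. Let $\mathcal C$ be the smooth projective model of the affine curve $$y^n=(x+\alpha_1)\cdots(x+\alpha_d),$$ which has genus $g=\tfrac12(n-1)(d-1)$, and let $\mathcal J$ be its jacobian, whose points are the classes $[D]$ of divisors $D$ of degree $0$ on $\mathcal C$ modulo linear equivalence. Let $\zeta\in K$ be a primitive $n$th root of unity, and write $\zeta$ also for the automorphism $(x,y)\mapsto(x,\zeta y)$ of $\mathcal C$ and for the automorphism of $\mathcal J$ that it induces. There is exactly one point of $\mathcal C$ at which the function $x$ is not regular; denote it by $\infty$. Let $\operatorname{AJ}_\infty:\mathcal C\to\mathcal J$, $P\mapsto[P-\infty]$, be the Abel–Jacobi map. For $r\ge 0$ let $$W_r=\{\operatorname{AJ}_\infty(P_1)+\cdots+\operatorname{AJ}_\infty(P_r)\;:\;P_1,\dots,P_r\in\mathcal C\}\subseteq\mathcal J$$ (so $W_0=\{0\}$), and let $\Theta=W_{g-1}$ be the theta divisor. Then: 1. $\operatorname{AJ}_\infty(\mathcal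 C)\cap(1-\zeta)\Theta=\{0\}$; 2. $\operatorname{AJ}_\infty(\mathcal C)\cap(\zeta-1)\Theta=\{0\}$. -/

import Mathlib

open Polynomial

noncomputable section

/-- The data defining a superelliptic curve `y ^ n = (x + α₁) ⋯ (x + α_d)` over a field `K`:
coprime integers `n, d ≥ 2`, with `n` not divisible by the characteristic of `K`, and distinct
elements `α₁, …, α_d` of `K`. -/
structure SuperellipticCurve (K : Type*) [Field K] where
  n : ℕ
  d : ℕ
  two_le_n : 2 ≤ n
  two_le_d : 2 ≤ d
  coprime : Nat.Coprime n d
  natCast_n_ne_zero : (n : K) ≠ 0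
  α : Fin d → K
  α_injective : Function.Injective α

namespace SuperellipticCurve

variable {K : Type*} [Field K] (C : SuperellipticCurve K)

/-- The genus `(n - 1) (d - 1) / 2`; the division is exact since `n` and `d` are coprime. -/
def genus : ℕ := (C.n - 1) * (C.d - 1) / 2

/-- The polynomial `(x + α₁) ⋯ (x + α_d)`. -/
def rhs : K[X] := ∏ i, (X + Polynomial.C (C.α i))

/-- The polynomial `y ^ n - (x + α₁) ⋯ (x + α_d)`, as a polynomial in `y` over `K[x]`. -/
def equation : K[X][X] := X ^ C.n - Polynomial.C C.rhs

theorem n_ne_zero : C.n ≠ 0 := by have := C.two_le_n; omega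

theorem equation_monic : C.equation.Monic :=
  monic_X_pow_sub_C _ C.n_ne_zero

theorem equation_irreducible : Irreducible C.equation := by
  classical
  have hd : 0 < C.d := by have := C.two_le_d; omega
  set i₀ : Fin C.d := ⟨0, hd⟩
  set p : K[X] := X + Polynomial.C (C.α i₀) with hp
  have hpp : Prime p := by
    have := prime_X_sub_C (-(C.α i₀))
    simpa [hp] using this
  have hprod : C.rhs = p * ∏ i ∈ Finset.univ.erase i₀, (X + Polynomial.C (C.α i)) :=
    (Finset.mul_prod_erase _ _ (Finset.mem_univ i₀)).symm
  have hnot : ¬ p ^ 2 ∣ C.rhs := by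
    rw [hprod, pow_two]
    intro h
    have h2 := (mul_dvd_mul_iff_left hpp.ne_zero).1 h
    obtain ⟨i, hi, hdiv⟩ := hpp.exists_mem_finset_dvd h2
    have h3 : (X + Polynomial.C (C.α i)).IsRoot (-(C.α i₀)) :=
      IsRoot.dvd (by simp [hp, IsRoot]) hdiv
    have h4 : C.α i = C.α i₀ := by
      have : -(C.α i₀) + C.α i = 0 := by simpa [IsRoot] using h3
      linear_combination this
    exact (Finset.ne_of_mem_erase hi) (C.α_injective h4)
  have hdeg : C.equation.degree = C.n := degree_X_pow_sub_C (Nat.pos_of_ne_zero C.n_ne_zero) _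
  refine irreducible_of_eisenstein_criterion (P := Ideal.span {p})
    ((Ideal.span_singleton_prime hpp.ne_zero).2 hpp) ?_ ?_ ?_ ?_ C.equation_monic.isPrimitive
  · rw [C.equation_monic.leadingCoeff]
    intro h
    exact hpp.not_isUnit (isUnit_of_dvd_one (Ideal.mem_span_singleton.1 h))
  · intro m hm
    rw [hdeg] at hm
    have hm' : m ≠ C.n := (by exact_mod_cast hm : m < C.n).ne
    rw [Ideal.mem_span_singleton, equation, coeff_sub, coeff_X_pow, if_neg hm', coeff_C]
    split_ifs
    · rw [hprod]; simp
    · simp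
  · rw [hdeg]; exact_mod_cast Nat.pos_of_ne_zero C.n_ne_zero
  · rw [Ideal.span_singleton_pow, Ideal.mem_span_singleton, equation, coeff_sub, coeff_X_pow,
      if_neg (Ne.symm C.n_ne_zero), coeff_C_zero, zero_sub, dvd_neg]
    exact hnot

/-- The ring `K[x, y] / (y ^ n - (x + α₁) ⋯ (x + α_d))`. -/
abbrev CoordinateRing : Type _ := AdjoinRoot C.equation

instance : IsDomain C.CoordinateRing :=
  AdjoinRoot.isDomain_of_prime C.equation_irreducible.prime

/-- The function field `K(C)`. -/
abbrev FunctionField : Type _ := FractionRing C.CoordinateRing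

/-- The function `x` on the curve. -/
def x : C.FunctionField :=
  algebraMap C.CoordinateRing C.FunctionField (AdjoinRoot.of C.equation X)

/-- The function `y` on the curve. -/
def y : C.FunctionField :=
  algebraMap C.CoordinateRing C.FunctionField (AdjoinRoot.root C.equation)

/-- The points of the smooth projective model of the curve (over algebraically closed `K`): the
discrete valuation rings of the function field `K(C)` that contain `K`. -/
@[ext]
structure Point where
  ring : ValuationSubring C.FunctionField
  algebraMap_mem : ∀ c : K, algebraMap K C.FunctionField c ∈ ring
  isDVR : IsDiscreteValuationRing ring

attribute [instance] Point.isDVR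

variable {C} in
/-- The order of vanishing `v_P(f)` of a rational function `f` at a point `P`
(with the junk value `0` at `f = 0`). -/
def Point.ord (P : C.Point) (f : C.FunctionField) : ℤ :=
  -WithZero.log ((IsDiscreteValuationRing.maximalIdeal P.ring).valuation C.FunctionField f)

variable {C} in
theorem Point.ord_mul (P : C.Point) {f g : C.FunctionField} (hf : f ≠ 0) (hg : g ≠ 0) :
    P.ord (f * g) = P.ord f + P.ord g := by
  unfold Point.ord
  rw [map_mul, WithZero.log_mul (by simpa using hf) (by simpa using hg)]
  ring

variable {C} in
theorem Point.ord_one (P : C.Point) : P.ord 1 = 0 := by simp [Point.ord]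

variable {C} in
theorem Point.ord_inv (P : C.Point) (f : C.FunctionField) : P.ord f⁻¹ = - P.ord f := by
  simp [Point.ord]

/-- The group of divisors on the curve. -/
abbrev Divisor : Type _ := C.Point →₀ ℤ

/-- The degree of a divisor (all points are rational over the algebraically closed field `K`). -/
def degree : C.Divisor →+ ℤ := Finsupp.degree

/-- The group of principal divisors `div(f) = ∑ v_P(f) P`, for nonzero rational functions `f`. -/
def principal : AddSubgroup C.Divisor where
  carrier := {D | ∃ f : C.FunctionField, f ≠ 0 ∧ ∀ P : C.Point, D P = P.ord f}
  zero_mem' := ⟨1, one_ne_zero, fun P => by simp [P.ord_one]⟩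
  add_mem' := by
    rintro D E ⟨f, hf, hD⟩ ⟨g, hg, hE⟩
    exact ⟨f * g, mul_ne_zero hf hg, fun P => by simp [P.ord_mul hf hg, hD P, hE P]⟩
  neg_mem' := by
    rintro D ⟨f, hf, hD⟩
    exact ⟨f⁻¹, inv_ne_zero hf, fun P => by simp [P.ord_inv, hD P]⟩

/-- The (group of points of the) jacobian: divisors of degree zero modulo linear equivalence. -/
abbrev Jacobian : Type _ := C.degree.ker ⧸ C.principal.addSubgroupOf C.degree.ker

/-- The class in the jacobian of a divisor of degree zero. -/
def divisorClass (D : C.Divisor) (hD : C.degree D = 0) : C.Jacobian :=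
  QuotientAddGroup.mk ⟨D, hD⟩

/-- The Abel-Jacobi map `P ↦ [P - Q]` with base point `Q`. -/
def abelJacobi (Q P : C.Point) : C.Jacobian :=
  C.divisorClass (Finsupp.single P 1 - Finsupp.single Q 1) (by simp [degree])

/-- The locus `W_r`: the image of `C ^ r` in the jacobian under the sum of `r` copies of the
Abel-Jacobi map with base point `Q`. -/
def W (Q : C.Point) (r : ℕ) : Set C.Jacobian :=
  Set.range fun P : Fin r → C.Point => ∑ i, C.abelJacobi Q (P i)

/-- The theta divisor `Θ = W_{g - 1}`. -/
def theta (Q : C.Point) : Set C.Jacobian := C.W Q (C.genus - 1)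

section Automorphisms

variable {C}

/-- The image of a point under the automorphism of the curve whose pullback on functions is `σ`:
a function `f` is regular at the image of `P` exactly when `σ f` is regular at `P`. -/
def Point.map (σ : C.FunctionField ≃ₐ[K] C.FunctionField) (P : C.Point) : C.Point where
  ring := P.ring.comap (σ : C.FunctionField →+* C.FunctionField)
  algebraMap_mem c := by
    simpa [ValuationSubring.mem_comap] using P.algebraMap_mem c
  isDVR := by
    let e : P.ring ≃+* P.ring.comap (σ : C.FunctionField →+* C.FunctionField) :=
      { toFun := fun a => ⟨σ.symm a, by simp [ValuationSubring.mem_comap]⟩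
        invFun := fun a => ⟨σ a, a.2⟩
        left_inv := fun a => by simp
        right_inv := fun a => by simp
        map_mul' := fun a b => by ext; simp
        map_add' := fun a b => by ext; simp }
    exact _root_.IsDiscreteValuationRing.RingEquivClass.isDiscreteValuationRing e

/-- An automorphism of the curve, given by its pullback on functions, as a bijection on points. -/
def pointEquiv (σ : C.FunctionField ≃ₐ[K] C.FunctionField) : C.Point ≃ C.Point where
  toFun := Point.map σ
  invFun := Point.map σ.symm
  left_inv P := by ext a; simp [Point.map, ValuationSubring.mem_comap]
  right_inv P := by ext a; simp [Point.map, ValuationSubring.mem_comap]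

theorem Point.ord_eq_of_irreducible (P : C.Point) (π : P.ring) (hπ : Irreducible π)
    (u : P.ringˣ) (k : ℤ) : P.ord ((u : P.ring) * (π : C.FunctionField) ^ k) = k := by
  set v := IsDiscreteValuationRing.maximalIdeal P.ring
  have hu : v.valuation C.FunctionField ((u : P.ring) : C.FunctionField) = 1 := by
    have : ((u : P.ring) : C.FunctionField) = algebraMap P.ring C.FunctionField u := rfl
    rw [this, IsDedekindDomain.HeightOneSpectrum.valuation_of_algebraMap]
    rw [IsDedekindDomain.HeightOneSpectrum.intValuation_eq_one_iff]
    exact fun h => (IsLocalRing.mem_maximalIdeal _).1 h u.isUnit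
  have hp : v.valuation C.FunctionField (π : C.FunctionField) = WithZero.exp (-1 : ℤ) := by
    have : (π : C.FunctionField) = algebraMap P.ring C.FunctionField π := rfl
    rw [this, IsDedekindDomain.HeightOneSpectrum.valuation_of_algebraMap]
    exact IsDedekindDomain.HeightOneSpectrum.intValuation_singleton _ hπ.ne_zero
      (hπ.maximalIdeal_eq)
  unfold Point.ord
  rw [map_mul, hu, one_mul, map_zpow₀, hp, WithZero.log_zpow, WithZero.log_exp]
  simp

theorem Point.ord_map (σ : C.FunctionField ≃ₐ[K] C.FunctionField) (P : C.Point)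
    (f : C.FunctionField) : (P.map σ).ord f = P.ord (σ f) := by
  by_cases hf : f = 0
  · simp [hf, Point.ord]
  let e : (P.map σ).ring ≃+* P.ring :=
    { toFun := fun a => ⟨σ a, a.2⟩
      invFun := fun a => ⟨σ.symm a, by simp [Point.map, ValuationSubring.mem_comap]⟩
      left_inv := fun a => by simp
      right_inv := fun a => by simp
      map_mul' := fun a b => by ext; simp
      map_add' := fun a b => by ext; simp }
  obtain ⟨π, hπ⟩ := IsDiscreteValuationRing.exists_irreducible (P.map σ).ring
  obtain ⟨k, u, hk⟩ : ∃ (k : ℤ) (u : (P.map σ).ringˣ),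
      f = ((u : (P.map σ).ring) : C.FunctionField) * (π : C.FunctionField) ^ k := by
    have hπ0 : (π : C.FunctionField) ≠ 0 := by simpa using hπ.ne_zero
    rcases (P.map σ).ring.mem_or_inv_mem f with h | h
    · obtain ⟨m, u, hu⟩ := IsDiscreteValuationRing.eq_unit_mul_pow_irreducible
        (x := (⟨f, h⟩ : (P.map σ).ring)) (by simpa [Subtype.ext_iff] using hf) hπ
      refine ⟨m, u, ?_⟩
      simpa using congrArg Subtype.val hu
    · obtain ⟨m, u, hu⟩ := IsDiscreteValuationRing.eq_unit_mul_pow_irreducible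
        (x := (⟨f⁻¹, h⟩ : (P.map σ).ring)) (by simpa [Subtype.ext_iff] using hf) hπ
      refine ⟨-m, u⁻¹, ?_⟩
      have h1 : f⁻¹ = ((u : (P.map σ).ring) : C.FunctionField) * (π : C.FunctionField) ^ m := by
        simpa using congrArg Subtype.val hu
      have h2 : ((u : (P.map σ).ring) : C.FunctionField) *
          ((u⁻¹ : (P.map σ).ringˣ) : (P.map σ).ring) = 1 :=
        congrArg Subtype.val u.mul_inv
      rw [← inv_inv f, h1, mul_inv, zpow_neg, zpow_natCast, ← eq_inv_of_mul_eq_one_right h2]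
  have h3 := P.ord_eq_of_irreducible (e π) ((MulEquiv.irreducible_iff e).2 hπ)
    (Units.map e u) k
  have h4 : σ f = ((Units.map (e : (P.map σ).ring →* P.ring) u : P.ring) : C.FunctionField) *
      ((e π : P.ring) : C.FunctionField) ^ k := by
    rw [hk, map_mul, map_zpow₀]; rfl
  rw [h4, h3, hk, Point.ord_eq_of_irreducible _ π hπ u k]

/-- The action on divisors (by pushforward) of the automorphism of the curve whose pullback on
functions is `σ`. -/
def divisorMap (σ : C.FunctionField ≃ₐ[K] C.FunctionField) : C.Divisor →+ C.Divisor :=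
  (Finsupp.domCongr (pointEquiv σ)).toAddMonoidHom

theorem degree_divisorMap (σ : C.FunctionField ≃ₐ[K] C.FunctionField) (D : C.Divisor) :
    C.degree (divisorMap σ D) = C.degree D := by
  simp [degree, divisorMap, Finsupp.equivMapDomain_eq_mapDomain, Finsupp.degree_mapDomain]

theorem divisorMap_mem_principal (σ : C.FunctionField ≃ₐ[K] C.FunctionField) {D : C.Divisor}
    (hD : D ∈ C.principal) : divisorMap σ D ∈ C.principal := by
  obtain ⟨f, hf, h⟩ := hD
  refine ⟨σ.symm f, by simpa using hf, fun P => ?_⟩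
  obtain ⟨Q, rfl⟩ := (pointEquiv σ).surjective P
  have : (pointEquiv σ Q).ord (σ.symm f) = Q.ord f := by
    have h1 := Q.ord_map σ (σ.symm f)
    rwa [AlgEquiv.apply_symm_apply] at h1
  rw [this, ← h Q]
  simp [divisorMap]

/-- The action on divisors of degree zero. -/
def divisorZeroMap (σ : C.FunctionField ≃ₐ[K] C.FunctionField) : C.degree.ker →+ C.degree.ker :=
  ((divisorMap σ).comp C.degree.ker.subtype).codRestrict C.degree.ker fun D => by
    rw [AddMonoidHom.mem_ker, AddMonoidHom.comp_apply, degree_divisorMap]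
    exact D.2

/-- The endomorphism of the jacobian induced by the automorphism of the curve whose pullback on
functions is `σ`. -/
def jacobianMap (σ : C.FunctionField ≃ₐ[K] C.FunctionField) : AddMonoid.End C.Jacobian :=
  QuotientAddGroup.map _ _ (divisorZeroMap σ) fun _ hD => divisorMap_mem_principal σ hD

end Automorphisms

theorem eval₂_equation_root {ζ : K} (hζ : ζ ^ C.n = 1) :
    C.equation.eval₂ (algebraMap K[X] C.CoordinateRing)
      (algebraMap K C.CoordinateRing ζ * AdjoinRoot.root C.equation) = 0 := by
  have key : ∀ z : C.CoordinateRing, C.equation.eval₂ (algebraMap K[X] C.CoordinateRing) z =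
      z ^ C.n - algebraMap K[X] C.CoordinateRing C.rhs := fun z => by
    have : ∀ q : K[X][X], q = X ^ C.n - Polynomial.C C.rhs → q.eval₂
        (algebraMap K[X] C.CoordinateRing) z = z ^ C.n - algebraMap K[X] C.CoordinateRing C.rhs := by
      rintro q rfl
      rw [eval₂_sub, eval₂_X_pow, eval₂_C]
    exact this _ rfl
  have h : C.equation.eval₂ (algebraMap K[X] C.CoordinateRing) (AdjoinRoot.root C.equation) = 0 :=
    AdjoinRoot.eval₂_root _
  rw [key] at h ⊢
  rwa [mul_pow, ← map_pow, hζ, map_one, one_mul]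

/-- For `ζ ^ n = 1`, the endomorphism `x ↦ x`, `y ↦ ζ y` of the coordinate ring. -/
def coordScale {ζ : K} (hζ : ζ ^ C.n = 1) : C.CoordinateRing →ₐ[K[X]] C.CoordinateRing :=
  AdjoinRoot.liftAlgHom C.equation (Algebra.ofId K[X] C.CoordinateRing)
    (algebraMap K C.CoordinateRing ζ * AdjoinRoot.root C.equation) (C.eval₂_equation_root hζ)

theorem ne_zero_of_pow {ζ : K} (hζ : ζ ^ C.n = 1) : ζ ≠ 0 := by
  rintro rfl
  simp [C.n_ne_zero] at hζ

theorem coordScale_root {ζ : K} (hζ : ζ ^ C.n = 1) :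
    C.coordScale hζ (AdjoinRoot.root C.equation) =
      algebraMap K C.CoordinateRing ζ * AdjoinRoot.root C.equation :=
  AdjoinRoot.liftAlgHom_root _ _ _ _

theorem coordScale_algebraMap {ζ : K} (hζ : ζ ^ C.n = 1) (c : K) :
    C.coordScale hζ (algebraMap K C.CoordinateRing c) = algebraMap K C.CoordinateRing c :=
  ((C.coordScale hζ).restrictScalars K).commutes c

theorem coordScale_comp {ζ ξ : K} (hζ : ζ ^ C.n = 1) (hξ : ξ ^ C.n = 1) (h : ζ * ξ = 1) :
    (C.coordScale hζ).comp (C.coordScale hξ) = AlgHom.id K[X] C.CoordinateRing := by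
  apply AdjoinRoot.algHom_ext
  rw [AlgHom.comp_apply, coordScale_root, map_mul, coordScale_root, coordScale_algebraMap,
    ← mul_assoc, ← map_mul, mul_comm ξ, h, map_one, one_mul, AlgHom.id_apply]

/-- For `ζ ^ n = 1`, the automorphism `x ↦ x`, `y ↦ ζ y` of the coordinate ring. -/
def coordAut {ζ : K} (hζ : ζ ^ C.n = 1) : C.CoordinateRing ≃ₐ[K] C.CoordinateRing :=
  (AlgEquiv.ofAlgHom (C.coordScale hζ) (C.coordScale (ζ := ζ⁻¹) (by rw [inv_pow, hζ, inv_one]))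
    (C.coordScale_comp _ _ (mul_inv_cancel₀ (C.ne_zero_of_pow hζ)))
    (C.coordScale_comp _ _ (inv_mul_cancel₀ (C.ne_zero_of_pow hζ)))).restrictScalars K

/-- For `ζ ^ n = 1`, the automorphism `x ↦ x`, `y ↦ ζ y` of the function field; it is the pullback
of functions along the automorphism `(x, y) ↦ (x, ζ y)` of the curve. -/
def zetaPullback {ζ : K} (hζ : ζ ^ C.n = 1) : C.FunctionField ≃ₐ[K] C.FunctionField :=
  IsFractionRing.algEquivOfAlgEquiv (C.coordAut hζ)

theorem zetaPullback_x {ζ : K} (hζ : ζ ^ C.n = 1) : C.zetaPullback hζ C.x = C.x := by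
  rw [zetaPullback, x, IsFractionRing.algEquivOfAlgEquiv_algebraMap]
  exact congrArg _ ((C.coordScale hζ).commutes X)

theorem zetaPullback_y {ζ : K} (hζ : ζ ^ C.n = 1) :
    C.zetaPullback hζ C.y = algebraMap K C.FunctionField ζ * C.y := by
  rw [zetaPullback, y, IsFractionRing.algEquivOfAlgEquiv_algebraMap,
    IsScalarTower.algebraMap_apply K C.CoordinateRing C.FunctionField, ← map_mul]
  exact congrArg _ (C.coordScale_root hζ)

/-- The endomorphism of the jacobian induced by the automorphism `(x, y) ↦ (x, ζ y)`. -/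
def zetaEnd {ζ : K} (hζ : ζ ^ C.n = 1) : AddMonoid.End C.Jacobian :=
  jacobianMap (C.zetaPullback hζ)

end SuperellipticCurve

end

/-! Write `∞` for the pole of `x`. A nonzero point of either intersection gives an effective divisor
`D` of degree `g - 1`, an automorphism `σ` of the curve fixing `∞` (`ζ` or its inverse), a point `R
≠ ∞` and a function `f` with divisor `R + σD - D - ∞`. The pole of `f` at `∞` is then simple.

Consider functions `v` whose divisor is at least `D` away from `∞`. The operator `v ↦ σ*(f v)`
preserves this condition: the zeros of `f` along `σD` and its poles along `D` are exactly what the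
pullback needs. It raises the pole order at `∞` by exactly one. A nonzero `v₀` of this kind with
pole order at most `2g - 1` exists by a dimension count (`exists_mem_ordAtLeast`): `g` monomials `x
^ i * y ^ j` against `g - 1` vanishing conditions. Iterating from `v₀` therefore reaches a function
regular on the affine part with pole order exactly `2g - 1`.

No such function exists. Regular functions on the affine curve are polynomials in `x` and `y`
(`exists_eq_ofCoeffs_of_forall`), so their pole orders lie in the semigroup generated by `n` and `d`
(`exists_ord_ofCoeffs_infinity`), and `2g - 1 = nd - n - d` is its Frobenius number
(`mul_add_mul_add_one_ne`). The contradiction is assembled in `eq_of_linearEquivalent`. -/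

noncomputable section

namespace SuperellipticCurve

variable {K : Type*} [Field K] {C : SuperellipticCurve K}

/-! ### Order of vanishing at a point -/

namespace Point

theorem val_ne_zero (P : C.Point) {f : C.FunctionField} (hf : f ≠ 0) :
    (IsDiscreteValuationRing.maximalIdeal P.ring).valuation C.FunctionField f ≠ 0 := by
  simpa using hf

theorem mem_ring_iff_val_le_one (P : C.Point) (f : C.FunctionField) :
    f ∈ P.ring ↔
      (IsDiscreteValuationRing.maximalIdeal P.ring).valuation C.FunctionField f ≤ 1 := by
  constructor
  · intro h
    exact IsDedekindDomain.HeightOneSpectrum.valuation_le_one _ (⟨f, h⟩ : P.ring)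
  · intro h
    obtain ⟨b, rfl⟩ := IsDiscreteValuationRing.exists_lift_of_le_one h
    exact b.2

theorem mem_ring_iff (P : C.Point) {f : C.FunctionField} (hf : f ≠ 0) :
    f ∈ P.ring ↔ 0 ≤ P.ord f := by
  rw [mem_ring_iff_val_le_one, ord, ← WithZero.log_le_log (P.val_ne_zero hf) one_ne_zero]
  simp

theorem min_ord_le_ord_add (P : C.Point) {f g : C.FunctionField} (hf : f ≠ 0) (hg : g ≠ 0)
    (hfg : f + g ≠ 0) : min (P.ord f) (P.ord g) ≤ P.ord (f + g) := by
  have h := Valuation.map_add ((IsDiscreteValuationRing.maximalIdeal P.ring).valuation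
    C.FunctionField) f g
  rw [le_max_iff, ← WithZero.log_le_log (P.val_ne_zero hfg) (P.val_ne_zero hf),
    ← WithZero.log_le_log (P.val_ne_zero hfg) (P.val_ne_zero hg)] at h
  rw [min_le_iff, ord, ord, ord]
  omega

theorem ord_pow (P : C.Point) (f : C.FunctionField) (k : ℕ) : P.ord (f ^ k) = k * P.ord f := by
  simp [ord]

theorem ord_algebraMap (P : C.Point) (c : K) : P.ord (algebraMap K C.FunctionField c) = 0 := by
  by_cases hc : c = 0
  · simp [hc, ord]
  have h0 : ∀ a : K, a ≠ 0 → 0 ≤ P.ord (algebraMap K C.FunctionField a) := fun a ha =>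
    (P.mem_ring_iff (by simpa using ha)).1 (P.algebraMap_mem a)
  have h1 := h0 c⁻¹ (inv_ne_zero hc)
  rw [map_inv₀, ord_inv] at h1
  have := h0 c hc
  omega

theorem ord_neg (P : C.Point) (f : C.FunctionField) : P.ord (-f) = P.ord f := by
  simp [ord, Valuation.map_neg]

theorem add_ne_zero_of_ord_lt (P : C.Point) {f g : C.FunctionField}
    (h : P.ord f < P.ord g) : f + g ≠ 0 := by
  intro h0
  rw [eq_neg_of_add_eq_zero_left h0, ord_neg] at h
  exact lt_irrefl _ h

theorem ord_add_of_lt (P : C.Point) {f g : C.FunctionField} (hf : f ≠ 0) (hg : g ≠ 0)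
    (h : P.ord f < P.ord g) : P.ord (f + g) = P.ord f := by
  have hfg := P.add_ne_zero_of_ord_lt h
  have h1 := P.min_ord_le_ord_add hf hg hfg
  have h2 := P.min_ord_le_ord_add hfg (neg_ne_zero.2 hg) (by simpa using hf)
  rw [ord_neg, add_neg_cancel_right] at h2
  omega

theorem exists_ord_eq_one (P : C.Point) : ∃ f : C.FunctionField, f ≠ 0 ∧ P.ord f = 1 := by
  obtain ⟨π, hπ⟩ := IsDiscreteValuationRing.exists_irreducible P.ring
  refine ⟨π, by simpa using hπ.ne_zero, ?_⟩
  simpa using P.ord_eq_of_irreducible π hπ 1 1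

/-- A finite sum of nonzero functions with distinct orders of vanishing has the order of
vanishing of one of them. -/
theorem exists_ord_sum_eq (P : C.Point) {ι : Type*} (s : Finset ι) (hs : s.Nonempty)
    (f : ι → C.FunctionField) (hf : ∀ i ∈ s, f i ≠ 0)
    (hinj : Set.InjOn (fun i => P.ord (f i)) s) :
    ∑ i ∈ s, f i ≠ 0 ∧ ∃ i ∈ s, P.ord (∑ i ∈ s, f i) = P.ord (f i) ∧
      ∀ j ∈ s, P.ord (f i) ≤ P.ord (f j) := by
  classical
  induction s using Finset.cons_induction with
  | empty => simp at hs
  | cons a s ha ih =>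
    rcases s.eq_empty_or_nonempty with rfl | hne
    · simpa using hf
    obtain ⟨h0, i, hi, hio, hmin⟩ := ih hne (fun j hj => hf j (by simp [hj]))
      (hinj.mono (by simp))
    have ha0 := hf a (by simp)
    have hne' : P.ord (f a) ≠ P.ord (f i) := fun h =>
      ha (by rwa [hinj (by simp) (by simp [hi]) h])
    rw [Finset.sum_cons]
    rcases lt_or_gt_of_ne hne' with h | h
    · rw [← hio] at h
      refine ⟨P.add_ne_zero_of_ord_lt h, a, by simp, P.ord_add_of_lt ha0 h0 h, ?_⟩
      intro j hj
      rcases Finset.mem_cons.1 hj with rfl | hj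
      · exact le_rfl
      · have := hmin j hj
        omega
    · rw [← hio] at h
      rw [add_comm]
      refine ⟨P.add_ne_zero_of_ord_lt h, i, by simp [hi], (P.ord_add_of_lt h0 ha0 h).trans hio, ?_⟩
      intro j hj
      rcases Finset.mem_cons.1 hj with rfl | hj
      · omega
      · exact hmin j hj

end Point

/-! ### Functions as polynomials in `y` over `K(x)` -/

theorem n_pos (C : SuperellipticCurve K) : 0 < C.n := Nat.pos_of_ne_zero C.n_ne_zero

theorem rhs_monic (C : SuperellipticCurve K) : C.rhs.Monic :=
  monic_prod_of_monic _ _ fun i _ => monic_X_add_C (C.α i)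

theorem natDegree_rhs (C : SuperellipticCurve K) : C.rhs.natDegree = C.d := by
  rw [rhs, natDegree_prod_of_monic _ _ fun i _ => monic_X_add_C (C.α i)]
  simp

theorem separable_rhs (C : SuperellipticCurve K) : C.rhs.Separable := by
  have h := separable_prod_X_sub_C_iff' (F := K) (s := (Finset.univ : Finset (Fin C.d)))
    (f := fun i => -C.α i)
  rw [rhs]
  simpa using h.2 fun i _ j _ hij => C.α_injective (neg_injective hij)

theorem natDegree_equation (C : SuperellipticCurve K) : C.equation.natDegree = C.n :=
  natDegree_X_pow_sub_C

theorem algebraMap_polynomial_injective (C : SuperellipticCurve K) :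
    Function.Injective (algebraMap K[X] C.FunctionField) := by
  rw [IsScalarTower.algebraMap_eq K[X] C.CoordinateRing C.FunctionField]
  refine (IsFractionRing.injective C.CoordinateRing C.FunctionField).comp ?_
  refine AdjoinRoot.of.injective_of_degree_ne_zero ?_
  rw [degree_eq_natDegree C.equation_monic.ne_zero, natDegree_equation]
  exact_mod_cast C.n_ne_zero

theorem algebraMap_polynomial_ne_zero {p : K[X]} (hp : p ≠ 0) :
    algebraMap K[X] C.FunctionField p ≠ 0 :=
  (map_ne_zero_iff _ C.algebraMap_polynomial_injective).2 hp

theorem algebraMap_X (C : SuperellipticCurve K) : algebraMap K[X] C.FunctionField X = C.x := rfl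

theorem aeval_x (p : K[X]) : aeval C.x p = algebraMap K[X] C.FunctionField p := by
  rw [← algebraMap_X, aeval_algebraMap_apply, aeval_X_left_apply]

theorem transcendental_x (C : SuperellipticCurve K) : Transcendental K C.x := by
  rw [transcendental_iff_injective]
  intro p q h
  rw [aeval_x, aeval_x] at h
  exact C.algebraMap_polynomial_injective h

theorem x_ne_zero (C : SuperellipticCurve K) : C.x ≠ 0 := algebraMap_polynomial_ne_zero X_ne_zero

theorem y_pow_n (C : SuperellipticCurve K) : C.y ^ C.n = algebraMap K[X] C.FunctionField C.rhs := by
  have h : C.equation.eval₂ (AdjoinRoot.of C.equation) (AdjoinRoot.root C.equation) = 0 :=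
    AdjoinRoot.eval₂_root _
  have h1 : ∀ q : K[X][X], q = X ^ C.n - Polynomial.C C.rhs → q.eval₂
      (AdjoinRoot.of C.equation) (AdjoinRoot.root C.equation) =
      (AdjoinRoot.root C.equation) ^ C.n - AdjoinRoot.of C.equation C.rhs := by
    rintro q rfl
    rw [eval₂_sub, eval₂_X_pow, eval₂_C]
  rw [h1 C.equation rfl, sub_eq_zero] at h
  rw [y, ← map_pow, h]
  rfl

theorem y_ne_zero (C : SuperellipticCurve K) : C.y ≠ 0 := by
  intro h
  have := C.y_pow_n
  rw [h, zero_pow C.n_ne_zero] at this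
  exact algebraMap_polynomial_ne_zero C.rhs_monic.ne_zero this.symm

variable (C) in
/-- The function `a₀(x) + a₁(x) y + ⋯ + a_{n-1}(x) y ^ (n - 1)`. -/
def ofCoeffs (a : ℕ → K[X]) : C.FunctionField :=
  ∑ j ∈ Finset.range C.n, algebraMap K[X] C.FunctionField (a j) * C.y ^ j

theorem exists_ofCoeffs_eq_algebraMap (f : C.CoordinateRing) :
    ∃ a : ℕ → K[X], algebraMap C.CoordinateRing C.FunctionField f = C.ofCoeffs a := by
  obtain ⟨p, rfl⟩ := AdjoinRoot.mk_surjective f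
  have hdeg : (p %ₘ C.equation).natDegree < C.n := by
    rw [← C.natDegree_equation]
    refine natDegree_modByMonic_lt _ C.equation_monic fun h => ?_
    have := C.natDegree_equation
    rw [h, natDegree_one] at this
    exact C.n_ne_zero this.symm
  refine ⟨(p %ₘ C.equation).coeff, ?_⟩
  have hp : AdjoinRoot.mk C.equation p = AdjoinRoot.mk C.equation (p %ₘ C.equation) := by
    rw [AdjoinRoot.mk_eq_mk]
    exact ⟨p /ₘ C.equation, by linear_combination -modByMonic_add_div p C.equation⟩
  rw [hp]
  conv_lhs => rw [as_sum_range_C_mul_X_pow' _ hdeg]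
  rw [map_sum, map_sum]
  refine Finset.sum_congr rfl fun j _ => ?_
  rw [map_mul, map_pow, AdjoinRoot.mk_X, map_mul, map_pow, AdjoinRoot.mk_C]
  rfl

instance : Module.Finite K[X] C.CoordinateRing :=
  C.equation_monic.finite_adjoinRoot

theorem exists_mul_eq_ofCoeffs (f : C.FunctionField) :
    ∃ c : K[X], c ≠ 0 ∧ ∃ a : ℕ → K[X],
      algebraMap K[X] C.FunctionField c * f = C.ofCoeffs a := by
  obtain ⟨g, h, hh, rfl⟩ := IsFractionRing.div_surjective (A := C.CoordinateRing) f
  obtain ⟨c, hc, e, he⟩ := (Algebra.IsAlgebraic.isAlgebraic (R := K[X]) h).exists_nonzero_dvd hh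
  obtain ⟨a, ha⟩ := exists_ofCoeffs_eq_algebraMap (e * g)
  refine ⟨c, hc, a, ?_⟩
  rw [← ha, IsScalarTower.algebraMap_apply K[X] C.CoordinateRing C.FunctionField, he, map_mul,
    map_mul]
  have := IsFractionRing.to_map_ne_zero_of_mem_nonZeroDivisors (K := C.FunctionField) hh
  field_simp

/-! ### The point at infinity: uniqueness and pole orders -/

namespace Point

theorem ord_x_neg {P : C.Point} (hP : C.x ∉ P.ring) : P.ord C.x < 0 := by
  rwa [P.mem_ring_iff C.x_ne_zero, not_le] at hP

theorem ord_algebraMap_polynomial {P : C.Point} (hP : C.x ∉ P.ring) {p : K[X]} (hp : p ≠ 0) :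
    P.ord (algebraMap K[X] C.FunctionField p) = p.natDegree * P.ord C.x := by
  have hx := ord_x_neg hP
  have hterm : ∀ i ∈ p.support, algebraMap K C.FunctionField (p.coeff i) * C.x ^ i ≠ 0 :=
    fun i hi => mul_ne_zero (by simpa using hi) (pow_ne_zero _ C.x_ne_zero)
  have hord : ∀ i ∈ p.support,
      P.ord (algebraMap K C.FunctionField (p.coeff i) * C.x ^ i) = i * P.ord C.x := fun i hi => by
    rw [P.ord_mul (by simpa using hi) (pow_ne_zero _ C.x_ne_zero), ord_algebraMap, ord_pow,
      zero_add]
  obtain ⟨-, i, hi, he, hmin⟩ := P.exists_ord_sum_eq p.support (by simpa using hp)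
    (fun i => algebraMap K C.FunctionField (p.coeff i) * C.x ^ i) hterm (by
      intro i hi j hj hij
      simp only [hord i hi, hord j hj] at hij
      exact_mod_cast mul_right_cancel₀ hx.ne hij)
  have hsum : algebraMap K[X] C.FunctionField p =
      ∑ i ∈ p.support, algebraMap K C.FunctionField (p.coeff i) * C.x ^ i := by
    rw [← aeval_x, aeval_def, eval₂_eq_sum]
    rfl
  have hdeg := natDegree_mem_support_of_nonzero hp
  have h1 := hmin _ hdeg
  rw [hord _ hi, hord _ hdeg] at h1
  have h2 : i ≤ p.natDegree := le_natDegree_of_mem_supp i hi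
  have h3 : p.natDegree ≤ i := by
    by_contra h
    push Not at h
    have : (i : ℤ) < p.natDegree := by exact_mod_cast h
    nlinarith
  rw [hsum, he, hord i hi, le_antisymm h2 h3]

theorem n_mul_ord_y {P : C.Point} (hP : C.x ∉ P.ring) :
    C.n * P.ord C.y = C.d * P.ord C.x := by
  rw [← ord_pow, y_pow_n, ord_algebraMap_polynomial hP C.rhs_monic.ne_zero, natDegree_rhs]

theorem n_mul_ord_monomial {P : C.Point} (hP : C.x ∉ P.ring) {p : K[X]} (hp : p ≠ 0) (j : ℕ) :
    C.n * P.ord (algebraMap K[X] C.FunctionField p * C.y ^ j) =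
      ((C.n * p.natDegree + C.d * j : ℕ) : ℤ) * P.ord C.x := by
  rw [P.ord_mul (algebraMap_polynomial_ne_zero hp) (pow_ne_zero _ C.y_ne_zero), ord_pow,
    ord_algebraMap_polynomial hP hp]
  push_cast
  linear_combination (j : ℤ) * n_mul_ord_y hP

end Point

/-- Reduce modulo `n` and cancel the unit `d`. Hence terms `aⱼ(x) y ^ j` with different `j < n` have
different orders at infinity and cannot cancel. -/
theorem eq_of_mul_add_mul_eq {i i' j j' : ℕ} (hj : j < C.n) (hj' : j' < C.n)
    (h : C.n * i + C.d * j = C.n * i' + C.d * j') : j = j' := by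
  have h1 : C.d * j ≡ C.d * j' [MOD C.n] := by
    have := congrArg (· % C.n) h
    simpa [Nat.ModEq, Nat.add_mod] using this
  exact (Nat.ModEq.cancel_left_of_coprime C.coprime h1).eq_of_lt_of_lt hj hj'

/-- Away from the affine part, the order of a function of the form `∑ aⱼ(x) y ^ j` is given by
its leading term. -/
theorem exists_n_mul_ord_ofCoeffs (a : ℕ → K[X]) (ha : ∃ j < C.n, a j ≠ 0) :
    ∃ j < C.n, a j ≠ 0 ∧ ∀ P : C.Point, C.x ∉ P.ring →
      C.n * P.ord (C.ofCoeffs a) =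
        ((C.n * (a j).natDegree + C.d * j : ℕ) : ℤ) * P.ord C.x := by
  classical
  set s := (Finset.range C.n).filter fun j => a j ≠ 0 with hs
  have hmem : ∀ {j}, j ∈ s ↔ j < C.n ∧ a j ≠ 0 := by simp [hs]
  have hne : s.Nonempty := ha.imp fun j hj => hmem.2 hj
  -- The dominant term is chosen before `P` is introduced, so one `j` serves every point at
  -- infinity; the uniqueness of that point rests on this uniformity.
  obtain ⟨j, hj, hmax⟩ := s.exists_max_image (fun j => C.n * (a j).natDegree + C.d * j) hne
  refine ⟨j, (hmem.1 hj).1, (hmem.1 hj).2, fun P hP => ?_⟩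
  have hx := Point.ord_x_neg hP
  have hsum : C.ofCoeffs a = ∑ j ∈ s, algebraMap K[X] C.FunctionField (a j) * C.y ^ j := by
    rw [ofCoeffs, hs, Finset.sum_filter_of_ne]
    intro i _ hi h0
    simp [h0] at hi
  have hord := fun {i} (hi : i ∈ s) => Point.n_mul_ord_monomial hP (hmem.1 hi).2 i
  obtain ⟨-, i, hi, he, hmin⟩ := P.exists_ord_sum_eq s hne
    (fun j => algebraMap K[X] C.FunctionField (a j) * C.y ^ j)
    (fun i hi => mul_ne_zero (algebraMap_polynomial_ne_zero (hmem.1 hi).2)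
      (pow_ne_zero _ C.y_ne_zero)) (by
      intro i hi j hj hij
      have h := congrArg (fun z => (C.n : ℤ) * z) hij
      simp only [hord hi, hord hj] at h
      exact eq_of_mul_add_mul_eq (hmem.1 hi).1 (hmem.1 hj).1
        (by exact_mod_cast mul_right_cancel₀ hx.ne h))
  rw [hsum, he, hord hi]
  have h1 := mul_le_mul_of_nonneg_left (hmin j hj) (Int.natCast_nonneg C.n)
  rw [hord hi, hord hj] at h1
  have h2 : ((C.n * (a j).natDegree + C.d * j : ℕ) : ℤ) ≤
      ((C.n * (a i).natDegree + C.d * i : ℕ) : ℤ) := (mul_le_mul_right_of_neg hx).1 h1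
  have h3 := hmax i hi
  rw [le_antisymm h3 (by exact_mod_cast h2)]

theorem ofCoeffs_eq_zero {a : ℕ → K[X]} (ha : ¬ ∃ j < C.n, a j ≠ 0) : C.ofCoeffs a = 0 := by
  push Not at ha
  exact Finset.sum_eq_zero fun j hj => by rw [ha j (Finset.mem_range.1 hj)]; simp

/-- All valuations at points at infinity are proportional. -/
theorem exists_n_mul_ord_eq {f : C.FunctionField} (hf : f ≠ 0) :
    ∃ m : ℤ, ∀ P : C.Point, C.x ∉ P.ring → C.n * P.ord f = m * P.ord C.x := by
  obtain ⟨c, hc, a, h⟩ := exists_mul_eq_ofCoeffs f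
  have hc' := algebraMap_polynomial_ne_zero (C := C) hc
  have ha : ∃ j < C.n, a j ≠ 0 := by
    by_contra ha
    rw [ofCoeffs_eq_zero ha] at h
    exact mul_ne_zero hc' hf h
  obtain ⟨j, -, -, hj⟩ := exists_n_mul_ord_ofCoeffs a ha
  refine ⟨((C.n * (a j).natDegree + C.d * j : ℕ) : ℤ) - C.n * c.natDegree, fun P hP => ?_⟩
  have h1 := hj P hP
  rw [← h, P.ord_mul hc' hf, Point.ord_algebraMap_polynomial hP hc] at h1
  linear_combination h1

/-- There is at most one point at infinity. -/
theorem eq_of_x_notMem {P Q : C.Point} (hP : C.x ∉ P.ring) (hQ : C.x ∉ Q.ring) : P = Q := by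
  ext f
  by_cases hf : f = 0
  · simp [hf]
  obtain ⟨m, hm⟩ := exists_n_mul_ord_eq hf
  have hn : (0 : ℤ) < C.n := by exact_mod_cast C.n_pos
  -- Since `x` has negative order, membership in the valuation ring depends only on the sign of `m`,
  -- which does not involve the point.
  have key : ∀ R : C.Point, C.x ∉ R.ring → (f ∈ R.ring ↔ m ≤ 0) := fun R hR => by
    have hx := Point.ord_x_neg hR
    rw [R.mem_ring_iff hf, ← mul_nonneg_iff_of_pos_left hn, hm R hR]
    constructor
    · intro h
      by_contra h0
      push Not at h0
      nlinarith
    · intro h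
      nlinarith
  rw [key P hP, key Q hQ]

/-- Two divisibilities: `n * ord y = d * ord x` with `n`, `d` coprime gives `n ∣ ord x`, while
proportionality applied to a uniformizer gives `n = m * ord x`. -/
theorem ord_x_infinity {P : C.Point} (hP : C.x ∉ P.ring) : P.ord C.x = -C.n := by
  have hx := Point.ord_x_neg hP
  obtain ⟨π, hπ, h1⟩ := P.exists_ord_eq_one
  obtain ⟨m, hm⟩ := exists_n_mul_ord_eq hπ
  have h2 := hm P hP
  rw [h1, mul_one] at h2
  have h3 : (C.n : ℤ) ∣ P.ord C.x := by
    have hco : IsCoprime (C.n : ℤ) (C.d : ℤ) := Nat.isCoprime_iff_coprime.2 C.coprime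
    exact hco.dvd_of_dvd_mul_left ⟨_, (Point.n_mul_ord_y hP).symm⟩
  have h4 : P.ord C.x ∣ (C.n : ℤ) := ⟨m, by rw [h2]; ring⟩
  have h5 : -P.ord C.x = C.n := Int.dvd_antisymm (by omega) (by omega) (by simpa using h4)
    (by simpa using h3)
  omega

theorem ord_monomial_infinity {P : C.Point} (hP : C.x ∉ P.ring) (i j : ℕ) :
    P.ord (C.x ^ i * C.y ^ j) = -((C.n * i + C.d * j : ℕ) : ℤ) := by
  have h := Point.n_mul_ord_monomial hP (p := X ^ i) (pow_ne_zero _ X_ne_zero) j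
  rw [natDegree_X_pow, map_pow, algebraMap_X, ord_x_infinity hP] at h
  have hn : (C.n : ℤ) ≠ 0 := by exact_mod_cast C.n_ne_zero
  apply mul_left_cancel₀ hn
  rw [h]
  ring

/-- The pole orders at infinity of functions `∑ aⱼ(x) y ^ j` with polynomial coefficients lie in
the semigroup generated by `n` and `d`. -/
theorem exists_ord_ofCoeffs_infinity {P : C.Point} (hP : C.x ∉ P.ring) {a : ℕ → K[X]}
    (ha : C.ofCoeffs a ≠ 0) : ∃ i j : ℕ, P.ord (C.ofCoeffs a) = -((C.n * i + C.d * j : ℕ) : ℤ) := by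
  obtain ⟨j, -, -, h⟩ := exists_n_mul_ord_ofCoeffs a (by
    by_contra h
    exact ha (ofCoeffs_eq_zero h))
  have h1 := h P hP
  rw [ord_x_infinity hP] at h1
  have hn : (C.n : ℤ) ≠ 0 := by exact_mod_cast C.n_ne_zero
  exact ⟨_, j, mul_left_cancel₀ hn (by rw [h1]; ring)⟩

/-! ### The function field over `K(x)`, and rationality of points -/

section

open IntermediateField

theorem adjoin_x_adjoin_y (C : SuperellipticCurve K) :
    IntermediateField.adjoin K⟮C.x⟯ {C.y} = ⊤ := by
  rw [eq_top_iff]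
  intro f _
  have hp : ∀ p : K[X], algebraMap K[X] C.FunctionField p ∈ IntermediateField.adjoin K⟮C.x⟯ {C.y} :=
      fun p => by
    rw [← aeval_x]
    exact _root_.algebraMap_mem (IntermediateField.adjoin K⟮C.x⟯ {C.y})
      (⟨aeval C.x p, algebra_adjoin_le_adjoin _ _ (aeval_mem_adjoin_singleton K C.x)⟩ : K⟮C.x⟯)
  obtain ⟨c, hc, a, h⟩ := exists_mul_eq_ofCoeffs f
  have hc' := algebraMap_polynomial_ne_zero (C := C) hc
  rw [eq_div_of_mul_eq hc' ((mul_comm _ _).trans h)]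
  refine div_mem (sum_mem fun j _ => mul_mem (hp _) (pow_mem (mem_adjoin_simple_self _ _) _)) (hp c)

/-- The polynomial `Y ^ n - r` with `r ≠ 0` is separable because `n` is invertible in `K`.
Separability over `K(x)` later makes the integral closure of `K[x]` a Dedekind domain. -/
theorem isSeparable_y (C : SuperellipticCurve K) : IsSeparable K⟮C.x⟯ C.y := by
  let r : K⟮C.x⟯ := ⟨aeval C.x C.rhs,
    algebra_adjoin_le_adjoin _ _ (aeval_mem_adjoin_singleton K C.x)⟩
  have hr : algebraMap K⟮C.x⟯ C.FunctionField r = algebraMap K[X] C.FunctionField C.rhs :=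
    aeval_x C.rhs
  have hr0 : r ≠ 0 := fun h => by
    rw [h, map_zero] at hr
    exact algebraMap_polynomial_ne_zero C.rhs_monic.ne_zero hr.symm
  have hn : (C.n : K⟮C.x⟯) ≠ 0 := by
    have := (map_ne_zero (algebraMap K K⟮C.x⟯)).2 C.natCast_n_ne_zero
    simpa using this
  refine (separable_X_pow_sub_C r hn hr0).of_dvd (minpoly.dvd _ _ ?_)
  simp [y_pow_n, hr]

instance finiteDimensional_adjoin_x : FiniteDimensional K⟮C.x⟯ C.FunctionField := by
  have h := adjoin.finiteDimensional C.isSeparable_y.isIntegral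
  rw [adjoin_x_adjoin_y] at h
  exact Module.Finite.equiv (topEquiv (F := K⟮C.x⟯) (E := C.FunctionField)).toLinearEquiv

instance isSeparable_adjoin_x : Algebra.IsSeparable K⟮C.x⟯ C.FunctionField := by
  have h := isSeparable_adjoin_simple_iff_isSeparable K⟮C.x⟯ C.FunctionField |>.2 C.isSeparable_y
  refine ⟨fun f => isSeparable_of_mem_isSeparable K⟮C.x⟯ C.FunctionField
    (L := IntermediateField.adjoin K⟮C.x⟯ {C.y}) ?_⟩
  rw [adjoin_x_adjoin_y]
  trivial

theorem trdeg_le_one (C : SuperellipticCurve K) : Algebra.trdeg K C.FunctionField ≤ 1 := by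
  open scoped IntermediateField.algebraAdjoinAdjoin in
  have : Algebra.IsAlgebraic (Algebra.adjoin K {C.x}) C.FunctionField :=
    Algebra.IsAlgebraic.trans _ K⟮C.x⟯ _
  simpa using Algebra.IsAlgebraic.trdeg_le_cardinalMk K ({C.x} : Set C.FunctionField)

theorem isAlgebraic_adjoin_of_transcendental {u : C.FunctionField} (hu : Transcendental K u) :
    Algebra.IsAlgebraic (Algebra.adjoin K {u}) C.FunctionField := by
  have h1 : AlgebraicIndependent K ![u] := by
    rw [algebraicIndependent_unique_type_iff]
    simpa using hu
  have h2 := h1.isTranscendenceBasis_of_lift_trdeg_le_of_finite (by simpa using C.trdeg_le_one)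
  have h3 := h2.isAlgebraic
  have h4 : Set.range ![u] = {u} := by simp
  rwa [h4] at h3

namespace Point

theorem ring_ne_top (P : C.Point) : ∃ f, f ∉ P.ring := by
  obtain ⟨f, hf, h⟩ := P.exists_ord_eq_one
  refine ⟨f⁻¹, fun h1 => ?_⟩
  rw [P.mem_ring_iff (inv_ne_zero hf), ord_inv, h] at h1
  omega

/-- Over an algebraically closed field, all points are rational. -/
theorem exists_ord_sub_pos [IsAlgClosed K] (P : C.Point) {u : C.FunctionField} (hu : u ∈ P.ring) :
    ∃ c : K, u - algebraMap K C.FunctionField c = 0 ∨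
      0 < P.ord (u - algebraMap K C.FunctionField c) := by
  -- If no constant is the value of `u` at `P`, every `u - c` is a unit there, and so is every
  -- nonzero polynomial in `u`, since it splits. Then `u` is transcendental and the function field
  -- is algebraic over `K[u]`, on which the order is identically zero. A function with a pole at `P`
  -- cannot satisfy such an algebraic relation: its terms have distinct orders.
  by_contra! hcon
  have hne := fun c => (hcon c).1
  have hord : ∀ c, P.ord (u - algebraMap K C.FunctionField c) = 0 := fun c =>
    le_antisymm (hcon c).2 ((P.mem_ring_iff (hne c)).1 (sub_mem hu (P.algebraMap_mem c)))
  have hunit : ∀ p : K[X], p ≠ 0 → aeval u p ≠ 0 ∧ P.ord (aeval u p) = 0 := by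
    intro p hp
    have hroots : ∀ s : Multiset K, aeval u (s.map fun c => X - Polynomial.C c).prod ≠ 0 ∧
        P.ord (aeval u (s.map fun c => X - Polynomial.C c).prod) = 0 := by
      intro s
      induction s using Multiset.induction with
      | empty => simp [ord_one]
      | cons c s ih =>
        rw [Multiset.map_cons, Multiset.prod_cons, map_mul, map_sub, aeval_X, aeval_C]
        exact ⟨mul_ne_zero (hne c) ih.1, by rw [P.ord_mul (hne c) ih.1, hord, ih.2, add_zero]⟩
    rw [(IsAlgClosed.splits p).eq_prod_roots, map_mul, aeval_C]
    have hl : algebraMap K C.FunctionField p.leadingCoeff ≠ 0 := by simpa using hp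
    refine ⟨mul_ne_zero hl (hroots _).1, ?_⟩
    rw [P.ord_mul hl (hroots _).1, ord_algebraMap, (hroots _).2, add_zero]
  have htr : Transcendental K u := by
    rintro ⟨p, hp, h⟩
    exact (hunit p hp).1 h
  obtain ⟨f, hf⟩ := P.ring_ne_top
  have hf0 : f ≠ 0 := fun h => hf (h ▸ zero_mem _)
  have hneg : P.ord f < 0 := by rwa [P.mem_ring_iff hf0, not_le] at hf
  obtain ⟨q, hq, hqf⟩ := (isAlgebraic_adjoin_of_transcendental htr).isAlgebraic f
  have hcoeff : ∀ i ∈ q.support, algebraMap _ C.FunctionField (q.coeff i) ≠ 0 ∧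
      P.ord (algebraMap _ C.FunctionField (q.coeff i)) = 0 := by
    intro i hi
    obtain ⟨p, hp⟩ := (Algebra.adjoin_singleton_eq_range_aeval K u).le (q.coeff i).2
    have hp' : aeval u p = algebraMap _ C.FunctionField (q.coeff i) := hp
    rw [← hp']
    refine hunit p fun h => mem_support_iff.1 hi ?_
    rw [h, map_zero] at hp'
    exact Subtype.ext hp'.symm
  have hterm : ∀ i ∈ q.support, P.ord (algebraMap _ C.FunctionField (q.coeff i) * f ^ i) =
      i * P.ord f := fun i hi => by
    rw [P.ord_mul (hcoeff i hi).1 (pow_ne_zero _ hf0), (hcoeff i hi).2, ord_pow, zero_add]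
  refine (P.exists_ord_sum_eq q.support (by simpa using hq)
    (fun i => algebraMap _ C.FunctionField (q.coeff i) * f ^ i)
    (fun i hi => mul_ne_zero (hcoeff i hi).1 (pow_ne_zero _ hf0)) ?_).1 ?_
  · intro i hi j hj hij
    simp only [hterm i hi, hterm j hj] at hij
    exact_mod_cast mul_right_cancel₀ hneg.ne hij
  · rw [← hqf, aeval_def, eval₂_eq_sum]
    rfl

end Point

end

/-! ### Regularity and integrality; existence of the point at infinity -/

section

open IntermediateField IsDedekindDomain
open scoped IntermediateField.algebraAdjoinAdjoin

theorem aeval_adjoin_surjective (t : C.FunctionField) : Function.Surjective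
    (aeval (R := K) (⟨t, Algebra.self_mem_adjoin_singleton K t⟩ : Algebra.adjoin K {t})) := by
  intro r
  obtain ⟨p, hp⟩ := (Algebra.adjoin_singleton_eq_range_aeval K t).le r.2
  refine ⟨p, Subtype.ext ?_⟩
  rw [← hp]
  exact (aeval_algHom_apply (Algebra.adjoin K {t}).val _ p).symm

theorem isPrincipalIdealRing_adjoin (t : C.FunctionField) :
    IsPrincipalIdealRing (Algebra.adjoin K {t}) :=
  IsPrincipalIdealRing.of_surjective _ (aeval_adjoin_surjective t)

theorem isDedekindDomain_integralClosure (t : C.FunctionField)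
    [FiniteDimensional K⟮t⟯ C.FunctionField] [Algebra.IsSeparable K⟮t⟯ C.FunctionField] :
    IsDedekindDomain (integralClosure (Algebra.adjoin K {t}) C.FunctionField) := by
  have := isPrincipalIdealRing_adjoin t
  exact integralClosure.isDedekindDomain (Algebra.adjoin K {t}) K⟮t⟯ C.FunctionField

/-- A function that is regular wherever `t` is regular is integral over `K[t]`. -/
theorem isIntegral_adjoin_of_forall (t : C.FunctionField)
    [FiniteDimensional K⟮t⟯ C.FunctionField] [Algebra.IsSeparable K⟮t⟯ C.FunctionField]
    {f : C.FunctionField} (hf : ∀ P : C.Point, t ∈ P.ring → f ∈ P.ring) :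
    IsIntegral (Algebra.adjoin K {t}) f := by
  have := isPrincipalIdealRing_adjoin t
  set R := integralClosure (Algebra.adjoin K {t}) C.FunctionField with hR
  have hded : IsDedekindDomain R := isDedekindDomain_integralClosure t
  have hfrac : IsFractionRing R C.FunctionField :=
    integralClosure.isFractionRing_of_finite_extension K⟮t⟯ C.FunctionField
  have hmem : ∀ (v : HeightOneSpectrum R) (r : R),
      (r : C.FunctionField) ∈ v.valuationSubringAtPrime C.FunctionField := by
    intro v r
    rw [v.valuationSubringAtPrime_eq_valuationSubring]
    exact v.valuation_le_one r
  -- Each maximal ideal of the Dedekind domain `R` yields a point at which `t` is regular, namely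
  -- its localization; an element integral at all of them lies in `R`.
  obtain ⟨r, hr⟩ := HeightOneSpectrum.mem_integers_of_valuation_le_one (R := R) C.FunctionField f
    fun v => by
      let P : C.Point :=
        { ring := v.valuationSubringAtPrime C.FunctionField
          algebraMap_mem := fun c => hmem v ⟨_, isIntegral_algebraMap (x := algebraMap K _ c)⟩
          isDVR := IsLocalization.AtPrime.isDiscreteValuationRing_of_dedekind_domain R v.ne_bot _ }
      have h : f ∈ v.valuationSubringAtPrime C.FunctionField := hf P
        (hmem v ⟨t, isIntegral_algebraMap
          (x := (⟨t, Algebra.self_mem_adjoin_singleton K t⟩ : Algebra.adjoin K {t}))⟩)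
      rwa [v.valuationSubringAtPrime_eq_valuationSubring] at h
  rw [← hr]
  exact r.2

theorem adjoin_inv_x (C : SuperellipticCurve K) : K⟮C.x⁻¹⟯ = K⟮C.x⟯ := by
  apply le_antisymm
  · rw [adjoin_simple_le_iff]
    exact inv_mem (mem_adjoin_simple_self _ _)
  · rw [adjoin_simple_le_iff]
    have h := inv_mem (mem_adjoin_simple_self K C.x⁻¹)
    rwa [inv_inv] at h

theorem transcendental_inv_x (C : SuperellipticCurve K) : Transcendental K C.x⁻¹ := fun h =>
  C.transcendental_x (by simpa using h.inv)

theorem isIntegral_polynomial_of_adjoin_x {f : C.FunctionField}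
    (h : IsIntegral (Algebra.adjoin K {C.x}) f) : IsIntegral K[X] f := by
  obtain ⟨p, hp, hpf⟩ := h
  obtain ⟨q, hq, -, hqm⟩ := lifts_and_degree_eq_and_monic
    ((lifts_iff_coeff_lifts p).2 fun i => aeval_adjoin_surjective C.x (p.coeff i)) hp
  refine ⟨q, hqm, ?_⟩
  rw [← hpf, ← hq, eval₂_map]
  congr 1
  refine Polynomial.ringHom_ext (fun a => ?_) ?_
  · simp only [RingHom.comp_apply, AlgHom.toRingHom_eq_coe, RingHom.coe_coe, aeval_C]
    rfl
  · simp only [RingHom.comp_apply, AlgHom.toRingHom_eq_coe, RingHom.coe_coe, aeval_X]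
    rfl

/-- A function regular at all points at which `x` is regular is integral over `K[x]`. -/
theorem isIntegral_of_forall {f : C.FunctionField}
    (hf : ∀ P : C.Point, C.x ∈ P.ring → f ∈ P.ring) : IsIntegral K[X] f :=
  isIntegral_polynomial_of_adjoin_x (isIntegral_adjoin_of_forall C.x hf)

/-- Were `x` regular everywhere, it would be integral over `K[1/x]`, a principal ideal domain with
fraction field `K(1/x) = K(x)`. Then `x` would be a polynomial in `1/x`, contradicting the
transcendence of `1/x`. -/
theorem exists_x_notMem (C : SuperellipticCurve K) : ∃ P : C.Point, C.x ∉ P.ring := by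
  by_contra! h
  have h1 : FiniteDimensional K⟮C.x⁻¹⟯ C.FunctionField ∧
      Algebra.IsSeparable K⟮C.x⁻¹⟯ C.FunctionField := by
    rw [adjoin_inv_x]
    exact ⟨inferInstance, inferInstance⟩
  obtain ⟨_, _⟩ := h1
  have hint := isIntegral_adjoin_of_forall C.x⁻¹ (f := C.x) fun P _ => h P
  have := isPrincipalIdealRing_adjoin C.x⁻¹
  have hint' : IsIntegral (Algebra.adjoin K {C.x⁻¹})
      (⟨C.x, by rw [adjoin_inv_x]; exact mem_adjoin_simple_self _ _⟩ : K⟮C.x⁻¹⟯) :=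
    (isIntegral_algebraMap_iff (algebraMap K⟮C.x⁻¹⟯ C.FunctionField).injective).1 hint
  obtain ⟨r, hr⟩ := IsIntegrallyClosed.isIntegral_iff.1 hint'
  obtain ⟨p, hp⟩ := aeval_adjoin_surjective C.x⁻¹ r
  have hp' : aeval C.x⁻¹ p = C.x := by
    exact (aeval_algHom_apply (Algebra.adjoin K {C.x⁻¹}).val _ p).trans
      ((congrArg Subtype.val hp).trans (congrArg (algebraMap K⟮C.x⁻¹⟯ C.FunctionField) hr))
  have h0 : aeval C.x⁻¹ (X * p - 1) = 0 := by
    rw [map_sub, map_mul, aeval_X, hp', map_one, inv_mul_cancel₀ C.x_ne_zero, sub_self]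
  have h2 : (X * p - 1 : K[X]) = 0 := by
    by_contra hne
    exact C.transcendental_inv_x ⟨_, hne, h0⟩
  simpa using congrArg (eval 0) h2

end

/-! ### Functions regular on the affine part are polynomials in `x` and `y` -/

/-- A prime `p` dividing `c` satisfies `p ^ n ∣ r ^ i`, so `r = p s`. Cancelling `p ^ i` leaves a
positive power of `p` dividing `s ^ i`, whence `p ^ 2 ∣ r`, against squarefreeness. -/
theorem _root_.IsCoprime.isUnit_of_pow_dvd_mul {R : Type*} [CommRing R] [IsDomain R]
    [UniqueFactorizationMonoid R] {r : R} (hr : Squarefree r) {n i : ℕ} (hi : i < n) {a c : R}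
    (hc : c ≠ 0) (hco : IsCoprime c a) (h : c ^ n ∣ a ^ n * r ^ i) : IsUnit c := by
  by_contra hu
  obtain ⟨p, hp, hpc⟩ := WfDvdMonoid.exists_irreducible_factor hu hc
  have hp' := UniqueFactorizationMonoid.irreducible_iff_prime.1 hp
  have h1 : p ^ n ∣ r ^ i := (pow_dvd_pow_of_dvd hpc n).trans (hco.pow.dvd_of_dvd_mul_left h)
  have h2 : p ∣ r := hp'.dvd_of_dvd_pow ((dvd_pow_self p (by omega)).trans h1)
  obtain ⟨s, rfl⟩ := h2
  rw [mul_pow, ← Nat.add_sub_of_le hi.le, pow_add,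
    mul_dvd_mul_iff_left (pow_ne_zero _ hp'.ne_zero)] at h1
  obtain ⟨t, rfl⟩ := hp'.dvd_of_dvd_pow ((dvd_pow_self p (by omega)).trans h1)
  exact hp'.not_isUnit (hr p ⟨t, by ring⟩)

/-- If `r` is squarefree and `i < n`, then `c ^ n ∣ a ^ n * r ^ i` forces `c ∣ a`. -/
theorem _root_.Squarefree.dvd_of_pow_dvd_pow_mul_pow {r : K[X]} (hr : Squarefree r) {n i : ℕ}
    (hi : i < n) {a c : K[X]} (hc : c ≠ 0) (h : c ^ n ∣ a ^ n * r ^ i) : c ∣ a := by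
  classical
  obtain ⟨c', hc'⟩ := EuclideanDomain.gcd_dvd_left c a
  obtain ⟨a', ha'⟩ := EuclideanDomain.gcd_dvd_right c a
  have hg : EuclideanDomain.gcd c a ≠ 0 := fun h0 => hc (EuclideanDomain.gcd_eq_zero_iff.1 h0).1
  have hab := EuclideanDomain.gcd_eq_gcd_ab c a
  set g := EuclideanDomain.gcd c a
  have hco : IsCoprime c' a' := by
    refine ⟨EuclideanDomain.gcdA c a, EuclideanDomain.gcdB c a, mul_left_cancel₀ hg ?_⟩
    linear_combination -hab - EuclideanDomain.gcdA c a * hc' - EuclideanDomain.gcdB c a * ha'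
  have hc0 : c' ≠ 0 := by
    rintro rfl
    exact hc (by rw [hc', mul_zero])
  have h1 : c' ^ n ∣ a' ^ n * r ^ i := by
    rw [hc', ha', mul_pow, mul_pow, mul_assoc] at h
    exact (mul_dvd_mul_iff_left (pow_ne_zero n hg)).1 h
  rw [hc', (hco.isUnit_of_pow_dvd_mul hr hi hc0 h1).mul_right_dvd]
  exact ⟨a', ha'⟩

/-- The quotient `a / c` lies in `K(x)` and is integral over `K[x]`, which is integrally closed. -/
theorem dvd_of_isIntegral {f : C.FunctionField} (hf : IsIntegral K[X] f) {a c : K[X]} (hc : c ≠ 0)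
    (h : algebraMap K[X] C.FunctionField c * f = algebraMap K[X] C.FunctionField a) : c ∣ a := by
  have : FaithfulSMul K[X] C.FunctionField :=
    (faithfulSMul_iff_algebraMap_injective _ _).2 C.algebraMap_polynomial_injective
  let _ := FractionRing.liftAlgebra K[X] C.FunctionField
  let F := FractionRing K[X]
  have hcF : algebraMap K[X] F c ≠ 0 := by simpa using hc
  have hcL := algebraMap_polynomial_ne_zero (C := C) hc
  have hfF : f = algebraMap F C.FunctionField (algebraMap K[X] F a / algebraMap K[X] F c) := by
    rw [map_div₀, ← IsScalarTower.algebraMap_apply, ← IsScalarTower.algebraMap_apply, ← h]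
    field_simp
  rw [hfF, isIntegral_algebraMap_iff (algebraMap F C.FunctionField).injective] at hf
  obtain ⟨b, hb⟩ := IsIntegrallyClosed.isIntegral_iff.1 hf
  refine ⟨b, IsFractionRing.injective K[X] F ?_⟩
  rw [eq_div_iff hcF] at hb
  rw [map_mul, ← hb, mul_comm]

theorem zetaPullback_algebraMap_polynomial {ζ : K} (hζ : ζ ^ C.n = 1) (p : K[X]) :
    C.zetaPullback hζ (algebraMap K[X] C.FunctionField p) = algebraMap K[X] C.FunctionField p := by
  rw [← aeval_x, ← AlgEquiv.coe_toAlgHom, ← aeval_algHom_apply, AlgEquiv.coe_toAlgHom, zetaPullback_x]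

theorem zetaPullback_ofCoeffs {ζ : K} (hζ : ζ ^ C.n = 1) (a : ℕ → K[X]) :
    C.zetaPullback hζ (C.ofCoeffs a) = ∑ j ∈ Finset.range C.n,
      algebraMap K C.FunctionField (ζ ^ j) * (algebraMap K[X] C.FunctionField (a j) * C.y ^ j) := by
  rw [ofCoeffs, map_sum]
  refine Finset.sum_congr rfl fun j _ => ?_
  rw [map_mul, map_pow, zetaPullback_y, zetaPullback_algebraMap_polynomial, map_pow]
  ring

/-- Orthogonality of the characters of the group of `n`th roots of unity; the exponent `n - i`
stands for `-i`. -/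
theorem sum_pow_mul_pow_eq {ζ : K} (hζ : IsPrimitiveRoot ζ C.n) {i j : ℕ} (hi : i < C.n)
    (hj : j < C.n) : ∑ k ∈ Finset.range C.n, (ζ ^ k) ^ (C.n - i) * (ζ ^ k) ^ j =
      if j = i then (C.n : K) else 0 := by
  have h1 : ∀ k, (ζ ^ k) ^ (C.n - i) * (ζ ^ k) ^ j = (ζ ^ (C.n - i + j)) ^ k := fun k => by ring
  simp only [h1]
  split_ifs with h
  · subst h
    rw [Nat.sub_add_cancel hi.le, hζ.pow_eq_one]
    simp
  · have hne : ζ ^ (C.n - i + j) ≠ 1 := by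
      rw [Ne, hζ.pow_eq_one_iff_dvd]
      rintro ⟨m, hm⟩
      rcases Nat.lt_trichotomy m 1 with hm1 | rfl | hm1
      · have : m = 0 := by omega
        subst this
        omega
      · omega
      · have : C.n * 2 ≤ C.n * m := Nat.mul_le_mul_left _ hm1
        omega
    have h2 := mul_geom_sum (ζ ^ (C.n - i + j)) C.n
    rw [← pow_mul, mul_comm _ C.n, pow_mul, hζ.pow_eq_one, one_pow, sub_self] at h2
    exact (mul_eq_zero.1 h2).resolve_left (sub_ne_zero.2 hne)

/-- A function that is regular on the affine part of the curve is a polynomial in `x` and `y`. -/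
theorem exists_eq_ofCoeffs_of_forall {ζ : K} (hζ : IsPrimitiveRoot ζ C.n) {f : C.FunctionField}
    (hf : ∀ P : C.Point, C.x ∈ P.ring → f ∈ P.ring) : ∃ a, f = C.ofCoeffs a := by
  obtain ⟨c, hc, a, h⟩ := exists_mul_eq_ofCoeffs f
  have hc' := algebraMap_polynomial_ne_zero (C := C) hc
  have hζk : ∀ k, (ζ ^ k) ^ C.n = 1 := fun k => by rw [pow_right_comm, hζ.pow_eq_one, one_pow]
  have hdvd : ∀ i < C.n, c ∣ a i := by
    intro i hi
    -- Projection to the `i`th eigenspace of `ζ`: the sum equals `n * aᵢ * y ^ i / c`, and it stays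
    -- regular on the affine part because the automorphisms fix `x`.
    set g := ∑ k ∈ Finset.range C.n, algebraMap K C.FunctionField ((ζ ^ k) ^ (C.n - i)) *
      C.zetaPullback (hζk k) f with hg
    have hgint : IsIntegral K[X] g := by
      refine isIntegral_of_forall fun P hP => sum_mem fun k _ => mul_mem (P.algebraMap_mem _) ?_
      refine hf (P.map (C.zetaPullback (hζk k))) ?_
      change C.zetaPullback (hζk k) C.x ∈ P.ring
      rwa [zetaPullback_x]
    have hcg : algebraMap K[X] C.FunctionField c * g =
        algebraMap K C.FunctionField C.n * (algebraMap K[X] C.FunctionField (a i) * C.y ^ i) := by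
      have h1 : ∀ k, algebraMap K[X] C.FunctionField c * C.zetaPullback (hζk k) f =
          ∑ j ∈ Finset.range C.n, algebraMap K C.FunctionField ((ζ ^ k) ^ j) *
            (algebraMap K[X] C.FunctionField (a j) * C.y ^ j) := fun k => by
        rw [← zetaPullback_ofCoeffs (hζk k), ← h, map_mul, zetaPullback_algebraMap_polynomial]
      rw [hg, Finset.mul_sum]
      simp only [mul_left_comm _ (algebraMap K C.FunctionField _), h1]
      simp only [Finset.mul_sum, ← mul_assoc, ← map_mul]
      rw [Finset.sum_comm]
      simp only [← Finset.sum_mul, ← map_sum]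
      rw [Finset.sum_congr rfl fun j hj => by
        rw [sum_pow_mul_pow_eq hζ hi (Finset.mem_range.1 hj)]]
      rw [Finset.sum_eq_single i]
      · simp
      · intro j _ hj
        simp [hj]
      · intro h
        exact absurd (Finset.mem_range.2 hi) h
    have hu : IsUnit (Polynomial.C ((C.n : K) ^ C.n)) :=
      isUnit_C.2 (pow_ne_zero _ C.natCast_n_ne_zero).isUnit
    -- The `n`th power removes `y` through `y ^ n = rhs`, leaving a divisibility in `K[x]`.
    have h2 : c ^ C.n ∣ Polynomial.C ((C.n : K) ^ C.n) * (a i ^ C.n * C.rhs ^ i) := by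
      refine dvd_of_isIntegral (hgint.pow C.n) (pow_ne_zero _ hc) ?_
      rw [map_pow, ← mul_pow, hcg, mul_pow, mul_pow, pow_right_comm, y_pow_n]
      simp only [map_mul, map_pow]
      rfl
    exact C.separable_rhs.squarefree.dvd_of_pow_dvd_pow_mul_pow hi hc (hu.dvd_mul_left.1 h2)
  choose! b hb using hdvd
  refine ⟨b, mul_left_cancel₀ hc' (h.trans ?_)⟩
  rw [ofCoeffs, ofCoeffs, Finset.mul_sum]
  refine Finset.sum_congr rfl fun j hj => ?_
  rw [hb j (Finset.mem_range.1 hj), map_mul, mul_assoc]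

/-! ### The numerical semigroup generated by `n` and `d` -/

theorem two_mul_genus (C : SuperellipticCurve K) : 2 * C.genus = (C.n - 1) * (C.d - 1) := by
  refine Nat.mul_div_cancel' ?_
  by_contra h
  rw [← even_iff_two_dvd, Nat.even_mul] at h
  push Not at h
  have h1 := C.two_le_n
  have h2 := C.two_le_d
  rw [Nat.even_sub (by omega), Nat.even_sub (by omega)] at h
  have h3 : Even C.n ∧ Even C.d := by simpa using h
  have h4 := Nat.dvd_gcd h3.1.two_dvd h3.2.two_dvd
  rw [C.coprime] at h4
  omega

theorem two_mul_genus_add (C : SuperellipticCurve K) :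
    2 * C.genus + C.n + C.d = C.n * C.d + 1 := by
  have h := C.two_mul_genus
  have h1 := C.two_le_n
  have h2 := C.two_le_d
  zify [show 1 ≤ C.n by omega, show 1 ≤ C.d by omega] at h ⊢
  linear_combination h

/-- The integer `2 g - 1` is a gap of the semigroup generated by `n` and `d`. -/
theorem mul_add_mul_add_one_ne (C : SuperellipticCurve K) (i j : ℕ) :
    C.n * i + C.d * j + 1 ≠ 2 * C.genus := by
  intro h
  have h1 := C.two_mul_genus_add
  -- Since `2g - 1 = nd - n - d`, the assumption reads `n (i + 1) + d (j + 1) = nd`, impossible for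
  -- coprime `n`, `d` and positive coefficients.
  refine C.coprime.mul_add_mul_ne_mul (Nat.succ_ne_zero i) (Nat.succ_ne_zero j) ?_
  simp only [Nat.succ_eq_add_one]
  linarith

/-- One of `s` and `2 g - 1 - s` belongs to the semigroup generated by `n` and `d`. -/
theorem exists_mul_add_mul_eq (C : SuperellipticCurve K) (s : ℕ) :
    ∃ i j : ℕ, C.n * i + C.d * j = s ∨ C.n * i + C.d * j + s + 1 = 2 * C.genus := by
  have hn := C.n_pos
  have hg := C.two_mul_genus_add
  obtain ⟨j, hj, hjs⟩ : ∃ j < C.n, C.d * j ≡ s [MOD C.n] := by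
    obtain ⟨k, hk1, hk2⟩ := Nat.chineseRemainder C.coprime s 0
    obtain ⟨j, rfl⟩ := (Nat.modEq_zero_iff_dvd).1 hk2
    exact ⟨j % C.n, Nat.mod_lt _ hn, ((Nat.mod_modEq j C.n).mul_left _).trans hk1⟩
  rcases le_or_gt (C.d * j) s with h | h
  · obtain ⟨i, hi⟩ := (Nat.modEq_iff_dvd' h).1 hjs
    exact ⟨i, j, Or.inl (by omega)⟩
  -- Here `d j - s` is a positive multiple `n (i + 1)`, so `2g - 1 - s = n i + d (n - 1 - j)`.
  · obtain ⟨i, hi⟩ := (Nat.modEq_iff_dvd' h.le).1 hjs.symm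
    obtain ⟨i, rfl⟩ : ∃ i', i = i' + 1 := Nat.exists_eq_succ_of_ne_zero (by
      rintro rfl
      omega)
    obtain ⟨m, hm⟩ : ∃ m, C.n = m + j + 1 := ⟨C.n - j - 1, by omega⟩
    refine ⟨i, m, Or.inr ?_⟩
    zify [h.le] at hi hg ⊢
    have hm' : (C.n : ℤ) = m + j + 1 := by exact_mod_cast hm
    linear_combination -hg - hi - (C.d : ℤ) * hm'

/-! ### Spaces of functions with prescribed zeros and poles -/

variable (C) in
/-- The space of functions vanishing to order at least `D P` at every point `P`. -/
def ordAtLeast (D : C.Divisor) : Submodule K C.FunctionField where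
  -- Zero is admitted separately because `ord` takes the default value `0` there.
  carrier := {f | f ≠ 0 → ∀ P : C.Point, D P ≤ P.ord f}
  zero_mem' h := absurd rfl h
  add_mem' {f g} hf hg hfg P := by
    by_cases hf0 : f = 0
    · subst hf0
      rw [zero_add] at hfg ⊢
      exact hg hfg P
    by_cases hg0 : g = 0
    · subst hg0
      rw [add_zero] at hfg ⊢
      exact hf hfg P
    exact (le_min (hf hf0 P) (hg hg0 P)).trans (P.min_ord_le_ord_add hf0 hg0 hfg)
  smul_mem' c f hf hcf P := by
    rw [Algebra.smul_def] at hcf ⊢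
    rw [P.ord_mul (left_ne_zero_of_mul hcf) (right_ne_zero_of_mul hcf), Point.ord_algebraMap,
      zero_add]
    exact hf (right_ne_zero_of_mul hcf) P

/-- Vanishing to one order more at a point is at most one linear condition. -/
theorem finrank_le_finrank_inf_ordAtLeast_add_one [IsAlgClosed K] (D : C.Divisor) (P : C.Point)
    (V : Submodule K C.FunctionField) [FiniteDimensional K V] (hV : V ≤ C.ordAtLeast D) :
    Module.finrank K V ≤
      Module.finrank K (V ⊓ C.ordAtLeast (D + Finsupp.single P 1) : Submodule K _) + 1 := by
  classical
  by_cases hw : ∃ w ∈ V, w ≠ 0 ∧ P.ord w = D P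
  · obtain ⟨w, hwV, hw0, hw⟩ := hw
    -- For `w` of minimal order at `P`, the quotient `v / w` is regular there with a value `c` in
    -- `K`, and `v - c w` vanishes to one order more.
    have hle : V ≤ (V ⊓ C.ordAtLeast (D + Finsupp.single P 1)) ⊔ K ∙ w := by
      intro v hv
      by_cases hv0 : v = 0
      · rw [hv0]
        exact zero_mem _
      have hvw : P.ord (v * w⁻¹) = P.ord v - P.ord w := by
        rw [P.ord_mul hv0 (inv_ne_zero hw0), Point.ord_inv, sub_eq_add_neg]
      obtain ⟨c, hc⟩ := P.exists_ord_sub_pos (u := v * w⁻¹) (by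
        rw [P.mem_ring_iff (mul_ne_zero hv0 (inv_ne_zero hw0)), hvw, hw]
        linarith [hV hv hv0 P])
      rw [← sub_add_cancel v (c • w)]
      refine Submodule.add_mem_sup ⟨sub_mem hv (V.smul_mem c hwV), ?_⟩
        (Submodule.smul_mem _ c (Submodule.mem_span_singleton_self w))
      intro h0 Q
      have hD := (sub_mem (hV hv) ((C.ordAtLeast D).smul_mem c (hV hwV))) h0 Q
      by_cases hQ : P = Q
      · subst hQ
        have he : v - c • w = (v * w⁻¹ - algebraMap K C.FunctionField c) * w := by
          rw [Algebra.smul_def]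
          field_simp
        rw [he] at h0 ⊢
        rw [P.ord_mul (left_ne_zero_of_mul h0) hw0, Finsupp.add_apply, Finsupp.single_eq_same]
        have := hc.resolve_left (left_ne_zero_of_mul h0)
        omega
      · rwa [Finsupp.add_apply, Finsupp.single_eq_of_ne (Ne.symm hQ), add_zero]
    calc Module.finrank K V ≤ _ := Submodule.finrank_mono hle
      _ ≤ _ := Submodule.finrank_add_le_finrank_add_finrank _ _
      _ = _ := by rw [finrank_span_singleton hw0]
  · push Not at hw
    have hle : V ≤ C.ordAtLeast (D + Finsupp.single P 1) := by
      intro v hv h0 Q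
      have hD := hV hv h0 Q
      by_cases hQ : P = Q
      · subst hQ
        have := hw v hv h0
        rw [Finsupp.add_apply, Finsupp.single_eq_same]
        omega
      · rwa [Finsupp.add_apply, Finsupp.single_eq_of_ne (Ne.symm hQ), add_zero]
    rw [inf_eq_left.2 hle]
    omega

theorem finrank_le_finrank_inf_ordAtLeast_add_card [IsAlgClosed K] {ι : Type*} (D : C.Divisor)
    (s : Finset ι) (p : ι → C.Point) (V : Submodule K C.FunctionField) [FiniteDimensional K V]
    (hV : V ≤ C.ordAtLeast D) :
    Module.finrank K V ≤ Module.finrank K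
      (V ⊓ C.ordAtLeast (D + ∑ i ∈ s, Finsupp.single (p i) 1) : Submodule K _) + s.card := by
  classical
  induction s using Finset.cons_induction with
  | empty => rw [Finset.sum_empty, add_zero, inf_eq_left.2 hV, Finset.card_empty, add_zero]
  | cons a s ha ih =>
    have h := finrank_le_finrank_inf_ordAtLeast_add_one (D + ∑ i ∈ s, Finsupp.single (p i) 1)
      (p a) (V ⊓ C.ordAtLeast (D + ∑ i ∈ s, Finsupp.single (p i) 1)) inf_le_right
    have hle : (V ⊓ C.ordAtLeast (D + ∑ i ∈ s, Finsupp.single (p i) 1)) ⊓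
        C.ordAtLeast (D + ∑ i ∈ s, Finsupp.single (p i) 1 + Finsupp.single (p a) 1) ≤
        V ⊓ C.ordAtLeast (D + ∑ i ∈ Finset.cons a s ha, Finsupp.single (p i) 1) := by
      rw [Finset.sum_cons, add_comm (Finsupp.single (p a) 1), ← add_assoc]
      exact inf_le_inf_right _ inf_le_left
    have := Submodule.finrank_mono hle
    rw [Finset.card_cons]
    omega

theorem Point.ord_y_nonneg {P : C.Point} (hP : C.x ∈ P.ring) : 0 ≤ P.ord C.y := by
  have h : algebraMap K[X] C.FunctionField C.rhs ∈ P.ring := by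
    rw [← aeval_x, aeval_eq_sum_range]
    refine sum_mem fun i _ => ?_
    rw [Algebra.smul_def]
    exact mul_mem (P.algebraMap_mem _) (pow_mem hP _)
  rw [P.mem_ring_iff (algebraMap_polynomial_ne_zero C.rhs_monic.ne_zero), ← y_pow_n, ord_pow] at h
  exact nonneg_of_mul_nonneg_right h (by exact_mod_cast C.n_pos)

/-- A special case of Riemann-Roch: for an effective divisor `D` of degree `g - 1`, there is a
nonzero function with divisor at least `D - (2 g - 1) ∞`. -/
theorem exists_mem_ordAtLeast [IsAlgClosed K] {Q : C.Point} (hQ : C.x ∉ Q.ring)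
    (p : Fin (C.genus - 1) → C.Point) (hg : 0 < C.genus) :
    ∃ v ≠ 0, v ∈ C.ordAtLeast
      (Finsupp.single Q (1 - 2 * C.genus : ℤ) + ∑ i, Finsupp.single (p i) 1) := by
  classical
  -- From each pair `{s, 2g - 1 - s}` with `s < g` a semigroup element is picked. The pairs are
  -- disjoint, so the `g` resulting monomials have distinct pole orders, all at most `2g - 1`, and
  -- are linearly independent.
  have hex := fun s : Fin C.genus => C.exists_mul_add_mul_eq s
  choose e j hej using hex
  let w : Fin C.genus → C.FunctionField := fun s => C.x ^ e s * C.y ^ j s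
  have hw0 : ∀ s, w s ≠ 0 := fun s =>
    mul_ne_zero (pow_ne_zero _ C.x_ne_zero) (pow_ne_zero _ C.y_ne_zero)
  have hord : ∀ s, Q.ord (w s) = -((C.n * e s + C.d * j s : ℕ) : ℤ) := fun s =>
    ord_monomial_infinity hQ _ _
  have hinj : Function.Injective fun s => Q.ord (w s) := by
    intro s t hst
    simp only [hord] at hst
    ext
    have := hej s
    have := hej t
    omega
  have hli : LinearIndependent K w := by
    rw [linearIndependent_iff']
    intro s c hs
    by_contra! hne
    obtain ⟨i, hi, hci⟩ := hne
    have hterm : ∀ i ∈ s.filter fun i => c i ≠ 0, c i • w i ≠ 0 := fun i hi =>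
      smul_ne_zero (Finset.mem_filter.1 hi).2 (hw0 i)
    have hterm' : ∀ i ∈ s.filter fun i => c i ≠ 0, Q.ord (c i • w i) = Q.ord (w i) := by
      intro i hi
      rw [Algebra.smul_def, Q.ord_mul (by simpa using (Finset.mem_filter.1 hi).2) (hw0 i),
        Point.ord_algebraMap, zero_add]
    refine (Q.exists_ord_sum_eq (s.filter fun i => c i ≠ 0)
      ⟨i, Finset.mem_filter.2 ⟨hi, hci⟩⟩ (fun i => c i • w i) hterm ?_).1 ?_
    · intro i hi j hj hij
      simp only [hterm' i hi, hterm' j hj] at hij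
      exact hinj hij
    · rw [Finset.sum_filter_of_ne, hs]
      intro i _ h h0
      simp [h0] at h
  have hV : Submodule.span K (Set.range w) ≤
      C.ordAtLeast (Finsupp.single Q (1 - 2 * C.genus : ℤ)) := by
    rw [Submodule.span_le]
    rintro _ ⟨s, rfl⟩ - P
    by_cases hP : Q = P
    · subst hP
      rw [Finsupp.single_eq_same, hord]
      have := hej s
      omega
    · rw [Finsupp.single_eq_of_ne (Ne.symm hP)]
      have hx : C.x ∈ P.ring := by
        by_contra h
        exact hP (eq_of_x_notMem hQ h)
      rw [P.ord_mul (pow_ne_zero _ C.x_ne_zero) (pow_ne_zero _ C.y_ne_zero), Point.ord_pow,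
        Point.ord_pow]
      have h1 := (P.mem_ring_iff C.x_ne_zero).1 hx
      have h2 := Point.ord_y_nonneg hx
      positivity
  have hfin : FiniteDimensional K (Submodule.span K (Set.range w)) :=
    FiniteDimensional.span_of_finite K (Set.finite_range w)
  have hdim := finrank_le_finrank_inf_ordAtLeast_add_card _ Finset.univ p _ hV
  rw [finrank_span_eq_card hli, Fintype.card_fin, Finset.card_univ, Fintype.card_fin] at hdim
  have hpos : 1 ≤ Module.finrank K (Submodule.span K (Set.range w) ⊓ C.ordAtLeast
      (Finsupp.single Q (1 - 2 * C.genus : ℤ) + ∑ i, Finsupp.single (p i) 1) : Submodule K _) := by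
    omega
  obtain ⟨v, hv, hv0⟩ := Submodule.exists_mem_ne_zero_of_ne_bot
    (Submodule.one_le_finrank_iff.1 hpos)
  exact ⟨v, hv0, hv.2⟩

/-! ### The main argument: raising pole orders up to `2g - 1` -/

/-- If `D` is effective of degree `g - 1` and `σ` is an automorphism fixing `∞`, then
`R + σ D ∼ D + ∞` forces `R = ∞`. -/
theorem eq_of_linearEquivalent [IsAlgClosed K] {ζ : K} (hζ : IsPrimitiveRoot ζ C.n) {Q R : C.Point}
    (hQ : C.x ∉ Q.ring) (σ : C.FunctionField ≃ₐ[K] C.FunctionField) (hσ : Q.map σ = Q)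
    (p : Fin (C.genus - 1) → C.Point) {f : C.FunctionField} (hf : f ≠ 0)
    (h : ∀ P : C.Point, (Finsupp.single R 1 + ∑ i, Finsupp.single ((p i).map σ) 1 -
      ∑ i, Finsupp.single (p i) 1 - Finsupp.single Q 1 : C.Divisor) P = P.ord f) : R = Q := by
  classical
  by_contra hRQ
  -- Positivity keeps the natural number `genus - 1` from being truncated.
  have hg : 0 < C.genus := by
    have h1 := C.two_mul_genus
    have h2 : 0 < (C.n - 1) * (C.d - 1) :=
      Nat.mul_pos (by have := C.two_le_n; omega) (by have := C.two_le_d; omega)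
    omega
  set D : C.Divisor := ∑ i, Finsupp.single (p i) 1 with hD
  set E : C.Divisor := ∑ i, Finsupp.single ((p i).map σ) 1 with hE
  have hED : ∀ P : C.Point, E (P.map σ) = D P := by
    intro P
    rw [hD, hE, Finsupp.finsetSum_apply, Finsupp.finsetSum_apply]
    refine Finset.sum_congr rfl fun i _ => ?_
    have := (pointEquiv σ).injective.eq_iff (a := p i) (b := P)
    change (p i).map σ = P.map σ ↔ _ at this
    simp [Finsupp.single_apply, this]
  have hD0 : ∀ P : C.Point, 0 ≤ D P := by
    intro P
    rw [hD, Finsupp.finsetSum_apply]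
    refine Finset.sum_nonneg fun i _ => ?_
    rw [Finsupp.single_apply]
    split_ifs <;> norm_num
  -- As `σ` fixes `Q`, the multiplicities of `D` and `σD` at `Q` cancel; only `-Q` remains because
  -- `R ≠ Q`.
  have hfQ : Q.ord f = -1 := by
    rw [← h Q]
    have h1 := hED Q
    rw [hσ] at h1
    simp [h1, hRQ]
  have hfP : ∀ P : C.Point, P.map σ ≠ Q → D P - D (P.map σ) ≤ (P.map σ).ord f := by
    intro P hP
    rw [← h (P.map σ)]
    simp only [Finsupp.sub_apply, Finsupp.add_apply, hED, Finsupp.single_apply, Ne.symm hP, if_false]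
    split_ifs <;> simp
  obtain ⟨v₀, hv₀, hv₀mem⟩ := exists_mem_ordAtLeast hQ p hg
  have hstep : ∀ k : ℕ, ∃ v ≠ 0, (∀ P ≠ Q, D P ≤ P.ord v) ∧ Q.ord v = Q.ord v₀ - k := by
    intro k
    induction k with
    | zero =>
      refine ⟨v₀, hv₀, fun P hP => ?_, by simp⟩
      simpa [Finsupp.single_apply, Ne.symm hP, hD] using hv₀mem hv₀ P
    | succ k ih =>
      obtain ⟨v, hv, hvP, hvQ⟩ := ih
      -- The order of `σ (f * v)` at `P` is that of `f * v` at `P.map σ`, where `f` contributes at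
      -- least `D P - D (P.map σ)` and `v` at least `D (P.map σ)`.
      refine ⟨σ (f * v), by simpa using ⟨hf, hv⟩, fun P hP => ?_, ?_⟩
      · rw [← Point.ord_map, Point.ord_mul _ hf hv]
        have hP' : P.map σ ≠ Q := fun h1 => hP ((pointEquiv σ).injective (h1.trans hσ.symm))
        linarith [hfP P hP', hvP _ hP']
      · rw [← Point.ord_map, hσ, Point.ord_mul _ hf hv, hfQ, hvQ]
        push_cast
        ring
  have hv₀Q : 1 - 2 * C.genus ≤ Q.ord v₀ := by
    have h1 := hv₀mem hv₀ Q
    rw [Finsupp.add_apply, Finsupp.single_eq_same] at h1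
    linarith [hD0 Q]
  -- By `hv₀Q` the integer is nonnegative, so this many steps bring the order at `Q` to exactly `1 -
  -- 2g`.
  obtain ⟨v, hv, hvP, hvQ⟩ := hstep (Q.ord v₀ + 2 * C.genus - 1).toNat
  obtain ⟨a, rfl⟩ := exists_eq_ofCoeffs_of_forall hζ (f := v) fun P hP => by
    rw [P.mem_ring_iff hv]
    refine (hD0 P).trans (hvP P ?_)
    rintro rfl
    exact hQ hP
  obtain ⟨i, j, hij⟩ := exists_ord_ofCoeffs_infinity hQ hv
  exact C.mul_add_mul_add_one_ne i j (by omega)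

/-! ### Translation to the jacobian -/

theorem map_zetaPullback_eq {ζ : K} (hζ : ζ ^ C.n = 1) {Q : C.Point} (hQ : C.x ∉ Q.ring) :
    Q.map (C.zetaPullback hζ) = Q := by
  refine eq_of_x_notMem ?_ hQ
  change C.zetaPullback hζ C.x ∉ Q.ring
  rwa [zetaPullback_x]

theorem Point.map_symm_map (σ : C.FunctionField ≃ₐ[K] C.FunctionField) (P : C.Point) :
    (P.map σ).map σ.symm = P :=
  (pointEquiv σ).symm_apply_apply P

theorem jacobianMap_abelJacobi (σ : C.FunctionField ≃ₐ[K] C.FunctionField) (Q P : C.Point) :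
    jacobianMap σ (C.abelJacobi Q P) = C.abelJacobi (Q.map σ) (P.map σ) := by
  refine congrArg (QuotientAddGroup.mk (s := C.principal.addSubgroupOf C.degree.ker))
    (Subtype.ext ?_)
  change divisorMap σ (Finsupp.single P 1 - Finsupp.single Q 1) = _
  rw [map_sub]
  simp [divisorMap, pointEquiv]

/-- Both sums run over the same index type, so their base-point terms cancel and only the `-Q`
attached to `R` survives. -/
theorem exists_ord_eq_of_sum_abelJacobi {ι : Type*} [Fintype ι] {Q R : C.Point}
    {p q : ι → C.Point}
    (h : ∑ i, C.abelJacobi Q (p i) - ∑ i, C.abelJacobi Q (q i) = C.abelJacobi Q R) :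
    ∃ f : C.FunctionField, f ≠ 0 ∧ ∀ P : C.Point,
      (Finsupp.single R 1 + ∑ i, Finsupp.single (q i) 1 -
        ∑ i, Finsupp.single (p i) 1 - Finsupp.single Q 1 : C.Divisor) P = P.ord f := by
  let δ : C.Point → C.degree.ker := fun P =>
    ⟨Finsupp.single P 1 - Finsupp.single Q 1, by simp [degree]⟩
  have hδ : ∀ P, C.abelJacobi Q P =
      QuotientAddGroup.mk' (C.principal.addSubgroupOf C.degree.ker) (δ P) := fun P => rfl
  simp only [hδ, ← map_sum, ← map_sub] at h
  obtain ⟨f, hf, hfP⟩ := AddSubgroup.mem_addSubgroupOf.1 (QuotientAddGroup.eq.1 h)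
  refine ⟨f, hf, fun P => ?_⟩
  rw [← hfP P]
  congr 1
  simp only [AddSubgroup.coe_add, AddSubgroup.coe_neg, AddSubgroup.coe_sub,
    AddSubgroup.val_finsetSum, δ, Finset.sum_sub_distrib]
  abel

theorem abelJacobi_self (Q : C.Point) : C.abelJacobi Q Q = 0 := by
  simp only [abelJacobi, sub_self]
  rfl

theorem zero_mem_W (Q : C.Point) (r : ℕ) : 0 ∈ C.W Q r :=
  ⟨fun _ => Q, by simp [abelJacobi_self]⟩

/-- If an endomorphism of the jacobian maps a point of the theta divisor to a point of the curve
only when the latter is the base point, its image of the theta divisor meets the curve in `0`. -/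
theorem range_abelJacobi_inter_image_theta {Q : C.Point} {φ : AddMonoid.End C.Jacobian}
    (h : ∀ (p : Fin (C.genus - 1) → C.Point) (R : C.Point),
      φ (∑ i, C.abelJacobi Q (p i)) = C.abelJacobi Q R → R = Q) :
    Set.range (C.abelJacobi Q) ∩ (fun D => φ D) '' C.theta Q = {0} := by
  ext z
  rw [Set.mem_singleton_iff]
  constructor
  · rintro ⟨⟨R, rfl⟩, _, ⟨p, rfl⟩, hp⟩
    rw [h p R hp, abelJacobi_self]
  · rintro rfl
    exact ⟨⟨Q, abelJacobi_self Q⟩, 0, zero_mem_W Q _, map_zero φ⟩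

end SuperellipticCurve

end

open SuperellipticCurve in
theorem mainTheorem2 {K : Type*} [Field K] [IsAlgClosed K] (C : SuperellipticCurve K)
    (ζ : K) (hζ : IsPrimitiveRoot ζ C.n) :
    ∃ infinity : C.Point, (∀ P : C.Point, C.x ∉ P.ring ↔ P = infinity) ∧
      Set.range (C.abelJacobi infinity) ∩
          (fun D => (1 - C.zetaEnd hζ.pow_eq_one) D) '' C.theta infinity = {0} ∧
      Set.range (C.abelJacobi infinity) ∩
          (fun D => (C.zetaEnd hζ.pow_eq_one - 1) D) '' C.theta infinity = {0} := by
  obtain ⟨Q, hQ⟩ := C.exists_x_notMem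
  have hσ := map_zetaPullback_eq hζ.pow_eq_one hQ
  have hmap : ∀ p : Fin (C.genus - 1) → C.Point, C.zetaEnd hζ.pow_eq_one
      (∑ i, C.abelJacobi Q (p i)) =
        ∑ i, C.abelJacobi Q ((p i).map (C.zetaPullback hζ.pow_eq_one)) := fun p => by
    rw [map_sum]
    refine Finset.sum_congr rfl fun i _ => ?_
    rw [zetaEnd, jacobianMap_abelJacobi, hσ]
  refine ⟨Q, fun P => ⟨fun hP => eq_of_x_notMem hP hQ, fun hP => hP ▸ hQ⟩,
    range_abelJacobi_inter_image_theta fun p R h => ?_,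
    range_abelJacobi_inter_image_theta fun p R h => ?_⟩
  · change ∑ i, C.abelJacobi Q (p i) - C.zetaEnd hζ.pow_eq_one _ = _ at h
    rw [hmap] at h
    obtain ⟨f, hf, hfP⟩ := exists_ord_eq_of_sum_abelJacobi h
    exact eq_of_linearEquivalent hζ hQ _ hσ p hf hfP
  · change C.zetaEnd hζ.pow_eq_one _ - ∑ i, C.abelJacobi Q (p i) = _ at h
    rw [hmap] at h
    obtain ⟨f, hf, hfP⟩ := exists_ord_eq_of_sum_abelJacobi h
    -- The opposite sign is the same situation with `σ⁻¹` in place of `σ` and `σD` in place of `D`.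
    refine eq_of_linearEquivalent hζ hQ (C.zetaPullback hζ.pow_eq_one).symm ?_
      (fun i => (p i).map (C.zetaPullback hζ.pow_eq_one)) hf ?_
    · conv_lhs => rw [← hσ]
      exact Point.map_symm_map _ Q
    · simpa only [Point.map_symm_map] using hfP
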